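/- Let $d\ge 2$ and let $g_2,\dots,g_d:[0,\infty)\to[0,\infty)$ be continuous and nondecreasing. Let $(\eta_t)_{t\ge0}$ be the symmetric nearest-neighbour exclusion process on $\mathbb Z^d$, i.e. the $\{0,1\}^{\mathbb Z^d}$-valued process with generator $$\mathcal L_d f(\eta)=\frac1{2d}\sum_{x\in\mathbb Z^d}\sum_{|y-x|=1}\eta(x)(1-\eta(y))\big(f(\eta^{x,y})-f(\eta)\big)$$ on functions $f$ of finitely many coordinates ($\eta^{x,y}$ is $\eta$ with the values at $x$ and $y$ exchanged), started from the deterministic configuration $$\eta_0(x)=\mathbf 1\big(x_1\le 0,\ |x_i|\le g_i(-x_1)\text{ for } i=2,\dots,d\big).$$ Let $\mathbb E_{\{g_i\}}$ denote the expectation for this process. For a function $z=z(t)\in\mathbb R$ of $t\ge0$ put $N_t=\sum_{x\in\mathbb Z^d,\ x_1>z(t)}\eta_t(x)$. Let $\zeta_t$ be the rate-one continuous time simple symmetric random walk on $\mathbb Z$, with $\zeta_0=0$ under $P_0$ (expectation $E_0$). For $A\subset\{2,\dots,d\}$ and $u\ge 0$ let $$G_A(u)=\prod_{i\in A}(2g_i(u)+1),\qquad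 \widehat G_A(u)=\int_0^u\sum_{i\in A}\ \prod_{l\in A\setminus\{i\}}(2g_l(v)+1)\,dv,$$ where empty products are $1$ and empty sums are $0$. Let $U=\{2\le i\le d:\sup_{u\ge0} g_i(u)=\infty\}$ and $B=\{2,\dots,d\}\setminus U$. Then, for each $i\in B$, the limit $L_i=\lim_{u\to\infty}(2\lfloor g_i(u)\rfloor+1)$ exists, and there is a constant $C>0$, depending only on $d$ and $\{g_i\}$, such that for every function $z$ and all $t\ge0$, $$\Big|\mathbb E_{\{g_i\}}[N_t]-\Big(\prod_{i\in B}L_i\Big)E_0\Big[\int_0^{(\zeta_{t/d}-z)_+}G_U(u)\,du\Big]\Big|\le C\Big(E_0\big[G_U(\zeta_{t/d}-z)\mathbf 1(\zeta_{t/d}>z)\big]+E_0\big[\widehat G_U(\zeta_{t/d}-z)\mathbf 1(\zeta_{t/d}>z)\big]\Big).$$ Here all expectations take values in $[0,\infty]$; if the right-hand side is finite then so are both terms on the left, and in general $|a-b|\le c$ means $a\le b+c$ and $b\le a+c$. Moreover, if $z$ is a function such that $\sup_{t\ge0}E_0\big[\int_0^{(\zeta_{t/d}-z)_+}G_U(u)\,du\big]<\infty$,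 and if for each $i\in U$ the function $g_i$ is continuously differentiable on $[0,\infty)$ with $\lim_{u\to\infty}g_i'(u)/g_i(u)=0$, then $$\lim_{t\to\infty}\Big(E_0\big[G_U(\zeta_{t/d}-z)\mathbf 1(\zeta_{t/d}>z)\big]+E_0\big[\widehat G_U(\zeta_{t/d}-z)\mathbf 1(\zeta_{t/d}>z)\big]\Big)=0.$$ -/

import Mathlib

open MeasureTheory ProbabilityTheory Filter Topology Set
open scoped NNReal ENNReal

noncomputable section

/-! ### The continuous time simple symmetric random walk on the integers -/

/-- The law of one step of the simple symmetric random walk: `±1` with probability `1/2` each. -/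
def stepLaw : Measure ℤ :=
  (2⁻¹ : ℝ≥0∞) • Measure.dirac (1 : ℤ) + (2⁻¹ : ℝ≥0∞) • Measure.dirac (-1 : ℤ)

/-- The law of the discrete time simple symmetric random walk from `0` after `m` steps. -/
def walkLaw : ℕ → Measure ℤ
  | 0 => Measure.dirac 0
  | m + 1 => Measure.conv (walkLaw m) stepLaw

/-- The law under `P₀` of `ζ_t`, the continuous time simple symmetric random walk on `ℤ` that
starts at `0` and jumps at rate `1`: the number of jumps up to time `t` is Poisson with mean `t`
and independent of the steps. Thus `E₀[f(ζ_t)]` is the integral of `f` against `srwLaw t`. -/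
def srwLaw (t : ℝ≥0) : Measure ℤ :=
  Measure.sum fun m : ℕ =>
    ENNReal.ofReal (Real.exp (-(t : ℝ)) * (t : ℝ) ^ m / (m.factorial : ℝ)) • walkLaw m

/-! ### The symmetric simple exclusion process on the lattice `ℤ^d` -/

/-- Sites of the lattice `ℤ^d`. -/
abbrev Site (d : ℕ) : Type := Fin d → ℤ

/-- Configurations in `{0,1}^{ℤ^d}`; `true` is an occupied site. The topology is the product
topology and the σ-algebra the product (equivalently, Borel) σ-algebra. -/
abbrev Config (d : ℕ) : Type := Site d → Bool

/-- The occupation variable `η(x)` as a number. -/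
def occ {d : ℕ} (η : Config d) (x : Site d) : ℝ := if η x = true then 1 else 0

/-- The configuration `η^{x,y}`, in which the values at `x` and `y` are exchanged. -/
def exchange {d : ℕ} (η : Config d) (x y : Site d) : Config d := fun u => η (Equiv.swap x y u)

/-- The generator of the symmetric nearest neighbour exclusion process,
`(1/2d) ∑_x ∑_{|y-x|=1} η(x) (1 - η(y)) (f(η^{x,y}) - f(η))`. The neighbours of `x` are `x ± e_i`.
For `f` depending on finitely many sites, only finitely many terms do not vanish. -/
def exclusionGenerator (d : ℕ) (f : Config d → ℝ) (η : Config d) : ℝ :=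
  1 / (2 * (d : ℝ)) * ∑' x : Site d, ∑ i : Fin d, ∑ s ∈ ({1, -1} : Finset ℤ),
    occ η x * (1 - occ η (x + Pi.single i s)) * (f (exchange η x (x + Pi.single i s)) - f η)

/-- `η` is, under `P`, a symmetric simple exclusion process on `ℤ^d` started from `η₀`: a càdlàg
process that solves the martingale problem for the exclusion generator on the functions that depend
on finitely many sites. -/
structure IsExclusionProcess (d : ℕ) {Ω : Type*} [MeasurableSpace Ω] (P : Measure Ω)
    (η : ℝ≥0 → Ω → Config d) (η₀ : Config d) : Prop where
  measurable : ∀ t, Measurable (η t)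
  right_cont : ∀ ω t, ContinuousWithinAt (fun s => η s ω) (Ici t) t
  left_lim : ∀ ω t, ∃ l : Config d, Tendsto (fun s => η s ω) (𝓝[<] t) (𝓝 l)
  initial : ∀ᵐ ω ∂P, η 0 ω = η₀
  martingale : ∀ (f : Config d → ℝ) (S : Finset (Site d)), DependsOn f (S : Set (Site d)) →
    Martingale
      (fun (t : ℝ≥0) ω => f (η t ω) - f (η 0 ω) -
        ∫ s in (0 : ℝ)..(t : ℝ), exclusionGenerator d f (η s.toNNReal ω))
      (Filtration.natural η fun t => (measurable t).stronglyMeasurable) P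

/-- `N(z)`: the number of particles at sites whose first coordinate is larger than `z`. -/
def numBeyond {n : ℕ} (η : Config (n + 1)) (z : ℝ) : ℝ≥0∞ :=
  ∑' x : {x : Site (n + 1) // z < (x 0 : ℝ)}, ENNReal.ofReal (occ η x)

/-! ### Shape functions and initial profiles

The dimension is `d = n + 1`. The first coordinate has index `0`, and the shape function of the
coordinate `i.succ` is `g i`, so that `g` lists `g_2, …, g_d`. Functions on `[0,∞)` are real
functions of which only the restriction to `Ici 0` matters. -/

/-- The initial profile of the shape functions: `x` is occupied exactly if `x_1 ≤ 0` and
`|x_i| ≤ g_i(-x_1)` for `i = 2, …, d`. -/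
def shapeProfile {n : ℕ} (g : Fin n → ℝ → ℝ) : Config (n + 1) := by
  classical
  exact fun x => decide (x 0 ≤ 0 ∧ ∀ i : Fin n, |(x i.succ : ℝ)| ≤ g i (-(x 0 : ℝ)))

/-- `g` is continuously differentiable on `[0,∞)` and `g'(u) / g(u) → 0` as `u → ∞`. -/
def SubexpCondition (g : ℝ → ℝ) : Prop :=
  ContDiffOn ℝ 1 g (Ici 0) ∧ Tendsto (fun u => derivWithin g (Ici 0) u / g u) atTop (𝓝 0)

/-- The set `U` of the indices of the unbounded shape functions. -/
def unboundedIdx {n : ℕ} (g : Fin n → ℝ → ℝ) : Finset (Fin n) := by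
  classical
  exact Finset.univ.filter fun i => ¬ BddAbove (g i '' Ici 0)

/-- `G_A(u) = ∏_{i ∈ A} (2 g_i(u) + 1)`. -/
def bigG {n : ℕ} (g : Fin n → ℝ → ℝ) (A : Finset (Fin n)) (u : ℝ) : ℝ :=
  ∏ i ∈ A, (2 * g i u + 1)

/-- `Ĝ_A(u) = ∫_0^u ∑_{i ∈ A} ∏_{l ∈ A, l ≠ i} (2 g_l(v) + 1) dv`. -/
def hatG {n : ℕ} (g : Fin n → ℝ → ℝ) (A : Finset (Fin n)) (u : ℝ) : ℝ :=
  ∫ v in (0 : ℝ)..u, ∑ i ∈ A, ∏ l ∈ A.erase i, (2 * g l v + 1)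

/-! ### The expectations in the estimate -/

/-- `E₀[∫_0^{(ζ_s - z)_+} G_A(u) du]`. -/
def meanIntG {n : ℕ} (g : Fin n → ℝ → ℝ) (A : Finset (Fin n)) (s : ℝ≥0) (z : ℝ) : ℝ≥0∞ :=
  ∫⁻ k : ℤ, ENNReal.ofReal (∫ u in (0 : ℝ)..(max ((k : ℝ) - z) 0), bigG g A u) ∂(srwLaw s)

/-- `E₀[h(ζ_s - z) 1(ζ_s > z)]`. -/
def meanBeyond (h : ℝ → ℝ) (s : ℝ≥0) (z : ℝ) : ℝ≥0∞ :=
  ∫⁻ k in {k : ℤ | z < (k : ℝ)}, ENNReal.ofReal (h ((k : ℝ) - z)) ∂(srwLaw s)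

/-- `E₀[G_A(ζ_s - z) 1(ζ_s > z)] + E₀[Ĝ_A(ζ_s - z) 1(ζ_s > z)]`. -/
def meanError {n : ℕ} (g : Fin n → ℝ → ℝ) (A : Finset (Fin n)) (s : ℝ≥0) (z : ℝ) : ℝ≥0∞ :=
  meanBeyond (bigG g A) s z + meanBeyond (hatG g A) s z

end

/-!
Testing the martingale problem on a single occupation variable, the exclusion constraint cancels
between the two endpoints of a bond, so the density `E[η_t(x)]` solves the linear discrete heat
equation. Bounded solutions of that equation are unique, hence the density is the initial profile
averaged over `d` independent rate-`1/d` walks. Summing over a hyperplane of sites with fixed first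
coordinate integrates out all directions but the first, and `E[N_t]` becomes the expectation of
`F(ζ_{t/d} - z)`, where `F(w)` is the number of initial particles in the layers `0, -1, …` at depth
less than `w`.

A layer at depth `j` holds `∏_i (2⌊g_i(j)⌋ + 1)` particles. Eventually the bounded factors equal
their limits, rounding the unbounded factors costs at most `2 ∑_i ∏_{l ≠ i} (2 g_l(j) + 1)`, and
comparing the sum over the layers with an integral costs at most one boundary term. The main term
is finite whenever the error is, because `P(ζ_s = k + 1) / P(ζ_s = k) → 0` as `k → ∞`.

For the last claim, subexponential growth makes the error functions at most
`C_δ + δ ∫_0^w G_U` for every `δ > 0`. The probability that `ζ_{t/d} > z` vanishes since the walk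
spreads out: no fixed number of sites carries mass in the limit, and by Markov's inequality the
bounded main term leaves little mass far beyond `z`.
-/

/-! ### Poisson randomisation of commuting operators -/

theorem lintegral_poissonMeasure (r : ℝ≥0) (f : ℕ → ℝ≥0∞) :
    ∫⁻ n, f n ∂(poissonMeasure r) = ∑' n, poissonMeasure r {n} * f n := by
  simp only [lintegral_countable', mul_comm]

theorem poissonMeasure_singleton_add_mul_choose (t : ℝ≥0) {p q : ℝ≥0} (hpq : q + p = 1)
    (i j : ℕ) :
    poissonMeasure t {i + j} * ((i + j).choose i * ((q : ℝ≥0∞) ^ i * (p : ℝ≥0∞) ^ j)) =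
      poissonMeasure (t * q) {i} * poissonMeasure (t * p) {j} := by
  have choose_mul : ((i + j).choose i * ((q : ℝ≥0∞) ^ i * (p : ℝ≥0∞) ^ j)) =
      ENNReal.ofReal ((i + j).choose i * ((q : ℝ) ^ i * (p : ℝ) ^ j)) := by
    rw [ENNReal.ofReal_mul (by positivity), ENNReal.ofReal_mul (by positivity),
      ENNReal.ofReal_pow (by positivity), ENNReal.ofReal_pow (by positivity),
      ENNReal.ofReal_natCast, ENNReal.ofReal_coe_nnreal, ENNReal.ofReal_coe_nnreal]
  have exp_split : Real.exp (-(t : ℝ)) = Real.exp (-(t * q)) * Real.exp (-(t * p)) := by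
    have hsum : (q : ℝ) + p = 1 := by exact_mod_cast hpq
    rw [← Real.exp_add]
    congr 1
    linear_combination (t : ℝ) * hsum
  simp only [choose_mul, poissonMeasure_singleton, NNReal.coe_mul]
  rw [← ENNReal.ofReal_mul (by positivity), ← ENNReal.ofReal_mul (by positivity),
    Nat.cast_add_choose, exp_split]
  congr 1
  field_simp
  ring

theorem tsum_sum_antidiagonal (F : ℕ × ℕ → ℝ≥0∞) :
    ∑' m, ∑ ij ∈ Finset.HasAntidiagonal.antidiagonal m, F ij = ∑' ij, F ij := by
  rw [← (Finset.HasAntidiagonal.sigmaAntidiagonalEquivProd (A := ℕ)).tsum_eq, ENNReal.tsum_sigma']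
  refine tsum_congr fun m => ?_
  rw [tsum_fintype]
  exact (Finset.sum_coe_sort _ F).symm

/-- Thinning: a Poisson number of trials splits into independent Poisson numbers of successes and
failures. -/
theorem lintegral_poissonMeasure_sum_antidiagonal (t : ℝ≥0) {p q : ℝ≥0} (hpq : q + p = 1)
    (f : ℕ → ℕ → ℝ≥0∞) :
    ∫⁻ m, ∑ ij ∈ Finset.HasAntidiagonal.antidiagonal m,
        (m.choose ij.1 * ((q : ℝ≥0∞) ^ ij.1 * (p : ℝ≥0∞) ^ ij.2)) * f ij.1 ij.2
          ∂(poissonMeasure t) =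
      ∫⁻ j, ∫⁻ i, f i j ∂(poissonMeasure (t * q)) ∂(poissonMeasure (t * p)) := by
  let F : ℕ × ℕ → ℝ≥0∞ := fun ij =>
    poissonMeasure (t * q) {ij.1} * poissonMeasure (t * p) {ij.2} * f ij.1 ij.2
  have weight_split : ∀ m : ℕ, poissonMeasure t {m} * ∑ ij ∈ Finset.HasAntidiagonal.antidiagonal m,
      (m.choose ij.1 * ((q : ℝ≥0∞) ^ ij.1 * (p : ℝ≥0∞) ^ ij.2)) * f ij.1 ij.2 =
        ∑ ij ∈ Finset.HasAntidiagonal.antidiagonal m, F ij := by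
    intro m
    rw [Finset.mul_sum]
    refine Finset.sum_congr rfl fun ij hij => ?_
    rw [Finset.HasAntidiagonal.mem_antidiagonal] at hij
    rw [← hij, ← mul_assoc, poissonMeasure_singleton_add_mul_choose t hpq]
  simp only [lintegral_poissonMeasure, weight_split]
  rw [tsum_sum_antidiagonal, ENNReal.tsum_prod', ENNReal.tsum_comm]
  refine tsum_congr fun j => ?_
  rw [← ENNReal.tsum_mul_left]
  refine tsum_congr fun i => ?_
  ring

section Operators

variable {X : Type*}

theorem smul_add_smul_pow_apply {A B : Module.End ℝ≥0∞ (X → ℝ≥0∞)} (hAB : Commute A B)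
    (q p : ℝ≥0∞) (m : ℕ) (φ : X → ℝ≥0∞) (x : X) :
    ((q • A + p • B) ^ m) φ x = ∑ ij ∈ Finset.HasAntidiagonal.antidiagonal m,
      (m.choose ij.1 * (q ^ ij.1 * p ^ ij.2)) * (A ^ ij.1 * B ^ ij.2) φ x := by
  have hc : Commute (q • A) (p • B) := (hAB.smul_left _).smul_right _
  rw [hc.add_pow', LinearMap.sum_apply, Finset.sum_apply]
  refine Finset.sum_congr rfl fun ij _ => ?_
  simp only [smul_pow, smul_mul_smul_comm, nsmul_eq_mul, Module.End.mul_apply,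
    Module.End.natCast_apply, LinearMap.smul_apply, Pi.smul_apply, smul_eq_mul, mul_assoc]

theorem lintegral_poissonMeasure_smul_add_smul_pow {A B : Module.End ℝ≥0∞ (X → ℝ≥0∞)}
    (hAB : Commute A B) (t : ℝ≥0) {p q : ℝ≥0} (hpq : q + p = 1) (φ : X → ℝ≥0∞) (x : X) :
    ∫⁻ m, (((q : ℝ≥0∞) • A + (p : ℝ≥0∞) • B) ^ m) φ x ∂(poissonMeasure t) =
      ∫⁻ j, ∫⁻ i, (A ^ i * B ^ j) φ x ∂(poissonMeasure (t * q)) ∂(poissonMeasure (t * p)) := by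
  simp only [smul_add_smul_pow_apply hAB]
  exact lintegral_poissonMeasure_sum_antidiagonal t hpq fun i j => (A ^ i * B ^ j) φ x

theorem lintegral_poissonMeasure_lazy_pow (A : Module.End ℝ≥0∞ (X → ℝ≥0∞)) (t : ℝ≥0)
    {p q : ℝ≥0} (hpq : q + p = 1) (φ : X → ℝ≥0∞) (x : X) :
    ∫⁻ m, (((q : ℝ≥0∞) • (1 : Module.End ℝ≥0∞ (X → ℝ≥0∞)) + (p : ℝ≥0∞) • A) ^ m) φ x
        ∂(poissonMeasure t) =
      ∫⁻ m, (A ^ m) φ x ∂(poissonMeasure (t * p)) := by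
  rw [lintegral_poissonMeasure_smul_add_smul_pow (Commute.one_left _) t hpq]
  simp only [one_pow, one_mul, lintegral_const, measure_univ, mul_one]

end Operators

/-! ### The random walk on the integers -/

section Shift

variable {X : Type*} [AddCommGroup X]

/-- The translation `f ↦ f (· + c)` of functions on an abelian group, of which the transition
operators of the random walks below are averages. -/
def shiftOp (R : Type*) [CommSemiring R] (c : X) : Module.End R (X → R) :=
  LinearMap.funLeft R R (· + c)

variable {R : Type*} [CommSemiring R]

theorem shiftOp_apply (c : X) (f : X → R) (x : X) : shiftOp R c f x = f (x + c) := rfl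

theorem shiftOp_pow_apply (c : X) (m : ℕ) (f : X → R) (x : X) :
    (shiftOp R c ^ m) f x = f (x + m • c) := by
  induction m generalizing x with
  | zero => simp only [pow_zero, Module.End.one_apply, zero_smul, add_zero]
  | succ m ih =>
    rw [pow_succ', Module.End.mul_apply, shiftOp_apply, ih, add_assoc, succ_nsmul']

theorem commute_shiftOp (a b : X) : Commute (shiftOp R a) (shiftOp R b) :=
  LinearMap.ext fun f => funext fun x => congrArg f (add_right_comm x a b)

end Shift

/-- The transition operator of the simple symmetric random walk on `ℤ`. -/
noncomputable def walkStep : Module.End ℝ≥0∞ (ℤ → ℝ≥0∞) :=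
  ((2⁻¹ : ℝ≥0) : ℝ≥0∞) • shiftOp ℝ≥0∞ 1 + ((2⁻¹ : ℝ≥0) : ℝ≥0∞) • shiftOp ℝ≥0∞ (-1)

theorem walkStep_apply (φ : ℤ → ℝ≥0∞) (k : ℤ) :
    walkStep φ k = 2⁻¹ * (φ (k + 1) + φ (k - 1)) := by
  rw [walkStep, ENNReal.coe_inv two_ne_zero]
  exact (mul_add _ _ _).symm

theorem lintegral_stepLaw (f : ℤ → ℝ≥0∞) : ∫⁻ y, f y ∂stepLaw = 2⁻¹ * (f 1 + f (-1)) := by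
  simp [stepLaw, mul_add]

instance isProbabilityMeasure_stepLaw : IsProbabilityMeasure stepLaw where
  measure_univ := by
    rw [← lintegral_one, lintegral_stepLaw, one_add_one_eq_two]
    exact ENNReal.inv_mul_cancel two_ne_zero ENNReal.ofNat_ne_top

instance isProbabilityMeasure_walkLaw (m : ℕ) : IsProbabilityMeasure (walkLaw m) := by
  induction m with
  | zero => exact Measure.dirac.isProbabilityMeasure
  | succ m ih => unfold walkLaw; infer_instance

theorem lintegral_walkLaw_succ (m : ℕ) (f : ℤ → ℝ≥0∞) :
    ∫⁻ y, f y ∂(walkLaw (m + 1)) = ∫⁻ y, walkStep f y ∂(walkLaw m) := by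
  rw [walkLaw, Measure.lintegral_conv (measurable_of_countable f)]
  refine lintegral_congr fun x => ?_
  rw [lintegral_stepLaw, walkStep_apply, sub_eq_add_neg]

theorem lintegral_walkLaw_add (m : ℕ) (φ : ℤ → ℝ≥0∞) (k : ℤ) :
    ∫⁻ y, φ (k + y) ∂(walkLaw m) = (walkStep ^ m) φ k := by
  induction m generalizing φ with
  | zero => simp [walkLaw]
  | succ m ih =>
    rw [lintegral_walkLaw_succ, pow_succ, Module.End.mul_apply, ← ih]
    refine lintegral_congr fun y => ?_
    simp only [walkStep_apply, add_assoc, add_sub_assoc]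

theorem lintegral_srwLaw (t : ℝ≥0) (f : ℤ → ℝ≥0∞) :
    ∫⁻ y, f y ∂(srwLaw t) = ∫⁻ m, ∫⁻ y, f y ∂(walkLaw m) ∂(poissonMeasure t) := by
  rw [srwLaw, lintegral_sum_measure, lintegral_poissonMeasure]
  refine tsum_congr fun m => ?_
  rw [lintegral_smul_measure, smul_eq_mul, poissonMeasure_singleton]

theorem lintegral_srwLaw_add (t : ℝ≥0) (φ : ℤ → ℝ≥0∞) (k : ℤ) :
    ∫⁻ y, φ (k + y) ∂(srwLaw t) = ∫⁻ m, (walkStep ^ m) φ k ∂(poissonMeasure t) := by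
  simp only [lintegral_srwLaw, lintegral_walkLaw_add]

instance isProbabilityMeasure_srwLaw (t : ℝ≥0) : IsProbabilityMeasure (srwLaw t) where
  measure_univ := by
    rw [← lintegral_one, lintegral_srwLaw]
    simp only [lintegral_one, measure_univ]

/-- The random walk is the difference of two independent Poisson variables, which count the jumps
to the right and to the left. -/
theorem lintegral_srwLaw_eq_poissonMeasure (s : ℝ≥0) (φ : ℤ → ℝ≥0∞) :
    ∫⁻ k, φ k ∂(srwLaw s) =
      ∫⁻ j : ℕ, ∫⁻ i : ℕ, φ (i - j) ∂(poissonMeasure (s * 2⁻¹)) ∂(poissonMeasure (s * 2⁻¹)) := by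
  have half_add_half : (2⁻¹ : ℝ≥0) + 2⁻¹ = 1 := by
    rw [← two_mul, mul_inv_cancel₀ two_ne_zero]
  calc ∫⁻ k, φ k ∂(srwLaw s)
      = ∫⁻ m, (walkStep ^ m) φ 0 ∂(poissonMeasure s) := by
        simp only [← lintegral_srwLaw_add, zero_add]
    _ = _ := by
        rw [walkStep, lintegral_poissonMeasure_smul_add_smul_pow (commute_shiftOp _ _) s
          half_add_half]
        simp only [Module.End.mul_apply, shiftOp_pow_apply, zero_add, nsmul_eq_mul, mul_one,
          mul_neg, sub_eq_add_neg]

theorem srwLaw_singleton (s : ℝ≥0) (k : ℤ) :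
    srwLaw s {k} = ∫⁻ j : ℕ, poissonMeasure (s * 2⁻¹) {i : ℕ | (i : ℤ) - j = k}
      ∂(poissonMeasure (s * 2⁻¹)) := by
  rw [← lintegral_indicator_one (measurableSet_singleton k), lintegral_srwLaw_eq_poissonMeasure]
  refine lintegral_congr fun j => ?_
  exact lintegral_indicator_one (MeasurableSet.of_discrete (s := {i : ℕ | (i : ℤ) - j = k}))

theorem srwLaw_singleton_natCast (s : ℝ≥0) (k : ℕ) :
    srwLaw s {(k : ℤ)} =
      ∫⁻ j, poissonMeasure (s * 2⁻¹) {j + k} ∂(poissonMeasure (s * 2⁻¹)) := by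
  rw [srwLaw_singleton]
  refine lintegral_congr fun j => congrArg _ (Set.ext fun i => ?_)
  rw [mem_ofPred_eq, mem_singleton_iff]
  omega

theorem poissonMeasure_singleton_succ_le (t : ℝ≥0) {k m : ℕ} (hkm : k ≤ m) :
    poissonMeasure t {m + 1} ≤ ENNReal.ofReal (t / (k + 1)) * poissonMeasure t {m} := by
  rw [poissonMeasure_singleton, poissonMeasure_singleton, ← ENNReal.ofReal_mul (by positivity)]
  refine ENNReal.ofReal_le_ofReal ?_
  calc Real.exp (-(t : ℝ)) * (t : ℝ) ^ (m + 1) / ((m + 1).factorial : ℝ)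
      = t / (m + 1) * (Real.exp (-(t : ℝ)) * (t : ℝ) ^ m / (m.factorial : ℝ)) := by
        rw [Nat.factorial_succ]
        push_cast
        field_simp
        ring
    _ ≤ t / (k + 1) * (Real.exp (-(t : ℝ)) * (t : ℝ) ^ m / (m.factorial : ℝ)) := by gcongr

theorem srwLaw_singleton_succ_le (s : ℝ≥0) (k : ℕ) :
    srwLaw s {((k + 1 : ℕ) : ℤ)} ≤
      ENNReal.ofReal ((s * 2⁻¹ : ℝ≥0) / (k + 1)) * srwLaw s {(k : ℤ)} := by
  rw [srwLaw_singleton_natCast, srwLaw_singleton_natCast,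
    ← lintegral_const_mul _ (measurable_of_countable _)]
  refine lintegral_mono fun j => ?_
  simpa only [add_assoc] using poissonMeasure_singleton_succ_le (s * 2⁻¹) (Nat.le_add_left k j)

/-! ### The random walk spreads out -/

theorem srwLaw_singleton_le_iSup (s : ℝ≥0) (k : ℤ) :
    srwLaw s {k} ≤ ⨆ m : ℕ, poissonMeasure (s * 2⁻¹) {m} := by
  rw [srwLaw_singleton]
  refine (lintegral_mono fun j => ?_).trans_eq
    ((lintegral_const _).trans (by rw [measure_univ, mul_one]))
  have hsub : {i : ℕ | (i : ℤ) - j = k}.Subsingleton := fun a ha b hb => by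
    rw [mem_ofPred_eq] at ha hb
    omega
  rcases hsub.eq_empty_or_singleton with h | ⟨m, h⟩ <;> rw [h]
  · simp only [measure_empty, zero_le]
  · exact le_iSup (fun m : ℕ => poissonMeasure (s * 2⁻¹) {m}) m

theorem pow_mul_exp_neg_le (k : ℕ) {r : ℝ} (hr : 0 ≤ r) :
    r ^ k * Real.exp (-r) ≤ (k / Real.exp 1) ^ k := by
  rcases k.eq_zero_or_pos with rfl | hk
  · simpa using hr
  have hk0 : (0 : ℝ) < k := by exact_mod_cast hk
  calc r ^ k * Real.exp (-r)
      = (k * (r / k)) ^ k * Real.exp (-r) := by rw [mul_div_cancel₀ _ hk0.ne']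
    _ ≤ (k * Real.exp (r / k - 1)) ^ k * Real.exp (-r) := by
        gcongr
        linarith [Real.add_one_le_exp (r / k - 1)]
    _ = (k / Real.exp 1) ^ k := by
        rw [mul_pow, ← Real.exp_nat_mul, mul_assoc, ← Real.exp_add, div_pow, ← Real.exp_nat_mul,
          div_eq_mul_inv ((k : ℝ) ^ k), ← Real.exp_neg]
        congr 2
        rw [mul_sub, mul_div_cancel₀ _ hk0.ne']
        ring

/-- The left side is largest at `r = k`, where Stirling's formula applies. -/
theorem poissonMeasure_singleton_le (r : ℝ≥0) {k : ℕ} (hk : k ≠ 0) :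
    poissonMeasure r {k} ≤ ENNReal.ofReal (√(2 * Real.pi * k))⁻¹ := by
  have : (0 : ℝ) < k := by exact_mod_cast Nat.pos_of_ne_zero hk
  rw [poissonMeasure_singleton]
  refine ENNReal.ofReal_le_ofReal ?_
  rw [div_le_iff₀ (by positivity), ← div_eq_inv_mul, le_div_iff₀ (by positivity)]
  calc Real.exp (-(r : ℝ)) * (r : ℝ) ^ k * √(2 * Real.pi * k)
      = √(2 * Real.pi * k) * ((r : ℝ) ^ k * Real.exp (-(r : ℝ))) := by ring
    _ ≤ √(2 * Real.pi * k) * (k / Real.exp 1) ^ k := by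
        gcongr
        exact pow_mul_exp_neg_le k r.2
    _ ≤ k.factorial := Stirling.le_factorial_stirling k

theorem tendsto_poissonMeasure_singleton (k : ℕ) :
    Tendsto (fun r : ℝ≥0 => poissonMeasure r {k}) atTop (𝓝 0) := by
  have h := ((Real.tendsto_pow_mul_exp_neg_atTop_nhds_zero k).div_const (k.factorial : ℝ)).comp
    (NNReal.tendsto_coe_atTop.2 tendsto_id)
  simpa only [poissonMeasure_singleton, zero_div, ENNReal.ofReal_zero, Function.comp_def, id,
    mul_comm] using ENNReal.tendsto_ofReal h

theorem tendsto_iSup_poissonMeasure_singleton :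
    Tendsto (fun r : ℝ≥0 => ⨆ k : ℕ, poissonMeasure r {k}) atTop (𝓝 0) := by
  refine ENNReal.tendsto_nhds_zero.2 fun ε hε => ?_
  have stirling_tendsto : Tendsto (fun k : ℕ => ENNReal.ofReal (√(2 * Real.pi * k))⁻¹) atTop
      (𝓝 0) := by
    have h : Tendsto (fun k : ℕ => 2 * Real.pi * (k : ℝ)) atTop atTop :=
      tendsto_natCast_atTop_atTop.const_mul_atTop (by positivity)
    simpa only [ENNReal.ofReal_zero, Function.comp_def] using ENNReal.tendsto_ofReal
      (tendsto_inv_atTop_zero.comp (Real.tendsto_sqrt_atTop.comp h))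
  obtain ⟨N, hN⟩ := eventually_atTop.1 (ENNReal.tendsto_nhds_zero.1 stirling_tendsto ε hε)
  have small_k : ∀ᶠ r : ℝ≥0 in atTop, ∀ k ∈ Finset.range (N + 1), poissonMeasure r {k} ≤ ε :=
    (Filter.eventually_all_finset _).2 fun k _ =>
      ENNReal.tendsto_nhds_zero.1 (tendsto_poissonMeasure_singleton k) ε hε
  filter_upwards [small_k] with r hr
  refine iSup_le fun k => ?_
  rcases lt_or_ge k (N + 1) with hk | hk
  · exact hr k (Finset.mem_range.2 hk)
  · exact (poissonMeasure_singleton_le r (by omega)).trans (hN k (by omega))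

theorem tendsto_iSup_srwLaw_singleton :
    Tendsto (fun s : ℝ≥0 => ⨆ k : ℤ, srwLaw s {k}) atTop (𝓝 0) :=
  tendsto_of_tendsto_of_tendsto_of_le_of_le tendsto_const_nhds
    (tendsto_iSup_poissonMeasure_singleton.comp
      (tendsto_id.atTop_mul_const' (inv_pos.2 two_pos)))
    (fun _ => zero_le) fun s => iSup_le fun k => srwLaw_singleton_le_iSup s k

/-! ### The random walk on the lattice -/

/-- The transition operator of the simple symmetric random walk on `ℤ^d`. It acts on real functions
in the heat equation for the density, and on `[0,∞]`-valued functions where densities are summed. -/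
noncomputable def latticeStep (R : Type*) [CommSemiring R] [Inv R] (d : ℕ) :
    Module.End R (Site d → R) :=
  (2 * (d : R))⁻¹ • ∑ i : Fin d, ∑ s ∈ ({1, -1} : Finset ℤ), shiftOp R (Pi.single i s)

theorem latticeStep_apply {R : Type*} [CommSemiring R] [Inv R] {d : ℕ} (f : Site d → R)
    (x : Site d) : latticeStep R d f x =
      (2 * (d : R))⁻¹ * ∑ i : Fin d, ∑ s ∈ ({1, -1} : Finset ℤ), f (x + Pi.single i s) := by
  simp only [latticeStep, LinearMap.smul_apply, LinearMap.sum_apply, Pi.smul_apply,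
    Finset.sum_apply, shiftOp_apply, smul_eq_mul]

theorem tsum_mul_add_right {X : Type*} [AddGroup X] (φ h : X → ℝ≥0∞) (c : X) :
    ∑' x, φ x * h (x + c) = ∑' x, φ (x + -c) * h x := by
  rw [← (Equiv.addRight c).tsum_eq fun x => φ (x + -c) * h x]
  simp only [Equiv.coe_addRight, add_neg_cancel_right]

theorem tsum_mul_latticeStep {d : ℕ} (φ h : Site d → ℝ≥0∞) :
    ∑' x, φ x * latticeStep ℝ≥0∞ d h x = ∑' x, latticeStep ℝ≥0∞ d φ x * h x := by
  have sum_out : ∀ (a : ℝ≥0∞) (f : Fin d → ℤ → Site d → ℝ≥0∞),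
      ∑' x, a * ∑ i : Fin d, ∑ s ∈ ({1, -1} : Finset ℤ), f i s x =
        a * ∑ i : Fin d, ∑ s ∈ ({1, -1} : Finset ℤ), ∑' x, f i s x := by
    intro a f
    rw [ENNReal.tsum_mul_left, Summable.tsum_finsetSum fun _ _ => ENNReal.summable]
    simp only [Summable.tsum_finsetSum fun _ _ => ENNReal.summable]
  calc ∑' x, φ x * latticeStep ℝ≥0∞ d h x
      = (2 * (d : ℝ≥0∞))⁻¹ * ∑ i : Fin d, ∑ s ∈ ({1, -1} : Finset ℤ),
          ∑' x, φ x * h (x + Pi.single i s) := by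
        simp only [latticeStep_apply, ← sum_out, Finset.mul_sum, mul_left_comm]
    _ = (2 * (d : ℝ≥0∞))⁻¹ * ∑ i : Fin d, ∑ s ∈ ({1, -1} : Finset ℤ),
          ∑' x, φ (x + Pi.single i s) * h x := by
        congr 1
        refine Finset.sum_congr rfl fun i _ => ?_
        rw [Finset.sum_pair (by norm_num), Finset.sum_pair (by norm_num), tsum_mul_add_right,
          tsum_mul_add_right, Pi.single_neg, neg_neg, add_comm]
    _ = ∑' x, latticeStep ℝ≥0∞ d φ x * h x := by
        simp only [latticeStep_apply, ← sum_out, Finset.mul_sum, Finset.sum_mul, mul_assoc]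

theorem tsum_mul_latticeStep_pow {d : ℕ} (m : ℕ) (φ h : Site d → ℝ≥0∞) :
    ∑' x, φ x * (latticeStep ℝ≥0∞ d ^ m) h x = ∑' x, (latticeStep ℝ≥0∞ d ^ m) φ x * h x := by
  induction m generalizing φ with
  | zero => rfl
  | succ m ih =>
    simp only [pow_succ' _ m, Module.End.mul_apply]
    rw [tsum_mul_latticeStep, ih, ← Module.End.mul_apply, ← Module.End.mul_apply,
      ← pow_succ, ← pow_succ']

/-- The transition operator of the first coordinate of the simple symmetric random walk on
`ℤ^{n+1}`, which moves with probability `1/(n+1)`. -/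
noncomputable def lazyStep (n : ℕ) : Module.End ℝ≥0∞ (ℤ → ℝ≥0∞) :=
  ((n / (n + 1 : ℕ) : ℝ≥0) : ℝ≥0∞) • 1 + ((1 / (n + 1 : ℕ) : ℝ≥0) : ℝ≥0∞) • walkStep

theorem lazyStep_apply (n : ℕ) (φ : ℤ → ℝ≥0∞) (k : ℤ) :
    lazyStep n φ k = (2 * ((n + 1 : ℕ) : ℝ≥0∞))⁻¹ * (φ (k + 1) + φ (k - 1) + n * (φ k + φ k)) := by
  have inv_mul_two : (2⁻¹ : ℝ≥0∞) * 2 = 1 :=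
    ENNReal.inv_mul_cancel two_ne_zero ENNReal.ofNat_ne_top
  have hn : ((n + 1 : ℕ) : ℝ≥0) ≠ 0 := by positivity
  calc lazyStep n φ k
      = n * ((n + 1 : ℕ) : ℝ≥0∞)⁻¹ * φ k +
          ((n + 1 : ℕ) : ℝ≥0∞)⁻¹ * (2⁻¹ * (φ (k + 1) + φ (k - 1))) := by
        rw [lazyStep, ENNReal.coe_div hn, ENNReal.coe_div hn, ENNReal.coe_natCast,
          ENNReal.coe_natCast, ENNReal.coe_one, one_div, ← walkStep_apply]
        rfl
    _ = 2⁻¹ * 2 * (n * ((n + 1 : ℕ) : ℝ≥0∞)⁻¹ * φ k) +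
          ((n + 1 : ℕ) : ℝ≥0∞)⁻¹ * (2⁻¹ * (φ (k + 1) + φ (k - 1))) := by
        rw [inv_mul_two, one_mul]
    _ = (2 * ((n + 1 : ℕ) : ℝ≥0∞))⁻¹ * (φ (k + 1) + φ (k - 1) + n * (φ k + φ k)) := by
        rw [ENNReal.mul_inv (Or.inl two_ne_zero) (Or.inl ENNReal.ofNat_ne_top)]
        ring

theorem latticeStep_comp_zero (n : ℕ) (φ : ℤ → ℝ≥0∞) :
    latticeStep ℝ≥0∞ (n + 1) (fun x => φ (x 0)) = fun x => lazyStep n φ (x 0) := by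
  funext x
  have sum_signs : ∀ f : ℤ → ℝ≥0∞, ∑ s ∈ ({1, -1} : Finset ℤ), f s = f 1 + f (-1) :=
    fun f => Finset.sum_pair (by norm_num)
  rw [latticeStep_apply, lazyStep_apply, Fin.sum_univ_succ]
  simp only [sum_signs, Pi.add_apply, Pi.single_eq_same, ne_eq, (Fin.succ_ne_zero _).symm,
    not_false_eq_true, Pi.single_eq_of_ne, add_zero, Finset.sum_const, Finset.card_univ,
    Fintype.card_fin, nsmul_eq_mul, sub_eq_add_neg]

theorem latticeStep_pow_comp_zero (n m : ℕ) (φ : ℤ → ℝ≥0∞) :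
    (latticeStep ℝ≥0∞ (n + 1) ^ m) (fun x => φ (x 0)) = fun x => (lazyStep n ^ m) φ (x 0) := by
  induction m with
  | zero => rfl
  | succ m ih => rw [pow_succ', pow_succ', Module.End.mul_apply, ih, latticeStep_comp_zero]; rfl

theorem lintegral_poissonMeasure_lazyStep_pow (n : ℕ) (t : ℝ≥0) (φ : ℤ → ℝ≥0∞) (k : ℤ) :
    ∫⁻ m, (lazyStep n ^ m) φ k ∂(poissonMeasure t) =
      ∫⁻ y, φ (k + y) ∂(srwLaw (t / (n + 1 : ℕ))) := by
  have stay_add_move : (n / (n + 1 : ℕ) : ℝ≥0) + 1 / (n + 1 : ℕ) = 1 := by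
    rw [← add_div, Nat.cast_succ]
    exact div_self (by positivity)
  rw [lintegral_srwLaw_add, lazyStep, lintegral_poissonMeasure_lazy_pow walkStep t stay_add_move,
    mul_one_div]

theorem tsum_mul_lintegral_latticeStep_pow (n : ℕ) (t : ℝ≥0) (φ : ℤ → ℝ≥0∞)
    (h : Site (n + 1) → ℝ≥0∞) :
    ∑' x, φ (x 0) * ∫⁻ m, (latticeStep ℝ≥0∞ (n + 1) ^ m) h x ∂(poissonMeasure t) =
      ∑' x, (∫⁻ k, φ (x 0 + k) ∂(srwLaw (t / (n + 1 : ℕ)))) * h x := by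
  calc ∑' x, φ (x 0) * ∫⁻ m, (latticeStep ℝ≥0∞ (n + 1) ^ m) h x ∂(poissonMeasure t)
      = ∫⁻ m, ∑' x, φ (x 0) * (latticeStep ℝ≥0∞ (n + 1) ^ m) h x ∂(poissonMeasure t) := by
        rw [lintegral_tsum fun _ => (measurable_of_countable _).aemeasurable]
        simp only [lintegral_const_mul _ (measurable_of_countable _)]
    _ = ∫⁻ m, ∑' x : Site (n + 1), (lazyStep n ^ m) φ (x 0) * h x ∂(poissonMeasure t) := by
        simp only [tsum_mul_latticeStep_pow _ (fun x : Site (n + 1) => φ (x 0)),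
          latticeStep_pow_comp_zero]
    _ = ∑' x, (∫⁻ k, φ (x 0 + k) ∂(srwLaw (t / (n + 1 : ℕ)))) * h x := by
        rw [lintegral_tsum fun _ => (measurable_of_countable _).aemeasurable]
        simp only [lintegral_mul_const _ (measurable_of_countable _),
          lintegral_poissonMeasure_lazyStep_pow]

theorem latticeStep_pow_nonneg {d : ℕ} {f : Site d → ℝ} (hf : ∀ x, 0 ≤ f x) (m : ℕ) (x : Site d) :
    0 ≤ (latticeStep ℝ d ^ m) f x := by
  induction m generalizing x with
  | zero => exact hf x
  | succ m ih =>
    rw [pow_succ', Module.End.mul_apply, latticeStep_apply]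
    exact mul_nonneg (by positivity)
      (Finset.sum_nonneg fun i _ => Finset.sum_nonneg fun s _ => ih _)

theorem ofReal_latticeStep_pow {d : ℕ} (hd : 1 ≤ d) {f : Site d → ℝ} (hf : ∀ x, 0 ≤ f x) (m : ℕ)
    (x : Site d) :
    ENNReal.ofReal ((latticeStep ℝ d ^ m) f x) =
      (latticeStep ℝ≥0∞ d ^ m) (fun y => ENNReal.ofReal (f y)) x := by
  induction m generalizing x with
  | zero => rfl
  | succ m ih =>
    have hpow := latticeStep_pow_nonneg hf m
    rw [pow_succ', pow_succ', Module.End.mul_apply, Module.End.mul_apply, latticeStep_apply,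
      latticeStep_apply, ENNReal.ofReal_mul (by positivity),
      ENNReal.ofReal_inv_of_pos (by positivity), ENNReal.ofReal_mul zero_le_two,
      ENNReal.ofReal_ofNat, ENNReal.ofReal_natCast,
      ENNReal.ofReal_sum_of_nonneg fun i _ => Finset.sum_nonneg fun s _ => hpow _]
    simp only [ENNReal.ofReal_sum_of_nonneg fun _ _ => hpow _, ih]

/-! ### Bounded solutions of the heat equation -/

section Heat

variable {X : Type*}

/-- The operator `A` has norm at most `K` on bounded functions with the supremum norm. -/
def SupNormLE (A : Module.End ℝ (X → ℝ)) (K : ℝ) : Prop :=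
  ∀ (f : X → ℝ) (c : ℝ), (∀ x, |f x| ≤ c) → ∀ x, |A f x| ≤ K * c

variable {A D : Module.End ℝ (X → ℝ)} {K M : ℝ} {u : ℝ → X → ℝ} {u₀ : X → ℝ}

theorem SupNormLE.abs_pow_apply_le (hA : SupNormLE A 1) {f : X → ℝ} {c : ℝ}
    (hf : ∀ x, |f x| ≤ c) (m : ℕ) (x : X) : |(A ^ m) f x| ≤ c := by
  induction m generalizing x with
  | zero => exact hf x
  | succ m ih => simpa only [pow_succ', Module.End.mul_apply, one_mul] using hA _ c ih x

theorem SupNormLE.sub_one (hA : SupNormLE A 1) : SupNormLE (A - 1) 2 := by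
  intro f c hf x
  rw [LinearMap.sub_apply, Pi.sub_apply, Module.End.one_apply]
  linarith [abs_sub (A f x) (f x), hA f c hf x, hf x]

/-- The Taylor polynomial of degree less than `n` of `t ↦ e^{tD} u₀`. -/
noncomputable def heatTaylor (D : Module.End ℝ (X → ℝ)) (u₀ : X → ℝ) (n : ℕ) (t : ℝ) : X → ℝ :=
  ∑ m ∈ Finset.range n, (t ^ m / m.factorial) • (D ^ m) u₀

theorem heatTaylor_apply (n : ℕ) (t : ℝ) (x : X) : heatTaylor D u₀ n t x =
    ∑ m ∈ Finset.range n, t ^ m / m.factorial * (D ^ m) u₀ x := by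
  simp only [heatTaylor, Finset.sum_apply, Pi.smul_apply, smul_eq_mul]

theorem apply_heatTaylor (n : ℕ) (t : ℝ) (x : X) : D (heatTaylor D u₀ n t) x =
    ∑ m ∈ Finset.range n, t ^ m / m.factorial * (D ^ (m + 1)) u₀ x := by
  simp only [heatTaylor, map_sum, map_smul, Finset.sum_apply, Pi.smul_apply, smul_eq_mul,
    pow_succ', Module.End.mul_apply]

theorem integral_pow_div_factorial (m : ℕ) (t : ℝ) :
    ∫ s in (0 : ℝ)..t, s ^ m / m.factorial = t ^ (m + 1) / (m + 1).factorial := by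
  rw [intervalIntegral.integral_div, integral_pow, zero_pow m.succ_ne_zero, sub_zero, div_div,
    Nat.factorial_succ, Nat.cast_mul, Nat.cast_succ]

theorem integral_apply_heatTaylor (n : ℕ) (t : ℝ) (x : X) :
    ∫ s in (0 : ℝ)..t, D (heatTaylor D u₀ n s) x = heatTaylor D u₀ (n + 1) t x - u₀ x := by
  simp only [apply_heatTaylor]
  rw [intervalIntegral.integral_finsetSum fun m _ =>
      Continuous.intervalIntegrable (by fun_prop) _ _, heatTaylor_apply, Finset.sum_range_succ']
  simp only [intervalIntegral.integral_mul_const, integral_pow_div_factorial, pow_zero,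
    Nat.factorial_zero, Nat.cast_one, div_one, one_mul, Module.End.one_apply, add_sub_cancel_right]

theorem abs_sub_heatTaylor_le (hD : SupNormLE D K) (hu : ∀ t x, |u t x| ≤ M)
    (hint : ∀ t x, IntervalIntegrable (fun s => D (u s) x) volume 0 t)
    (heq : ∀ t, 0 ≤ t → ∀ x, u t x = u₀ x + ∫ s in (0 : ℝ)..t, D (u s) x)
    (n : ℕ) {t : ℝ} (ht : 0 ≤ t) (x : X) :
    |u t x - heatTaylor D u₀ n t x| ≤ (K * t) ^ n / n.factorial * M := by
  induction n generalizing t x with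
  | zero => simpa [heatTaylor] using hu t x
  | succ n ih =>
    have remainder_succ : u t x - heatTaylor D u₀ (n + 1) t x =
        ∫ s in (0 : ℝ)..t, D (u s - heatTaylor D u₀ n s) x := by
      simp only [map_sub, Pi.sub_apply]
      rw [intervalIntegral.integral_sub (hint t x), integral_apply_heatTaylor, heq t ht x]
      · ring
      · simp only [apply_heatTaylor]
        exact Continuous.intervalIntegrable (by fun_prop) _ _
    rw [remainder_succ]
    calc ‖∫ s in (0 : ℝ)..t, D (u s - heatTaylor D u₀ n s) x‖
        ≤ ∫ s in (0 : ℝ)..t, K * ((K * s) ^ n / n.factorial * M) :=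
          intervalIntegral.norm_integral_le_of_norm_le ht
            (ae_of_all _ fun s hs => hD _ _ (fun y => ih hs.1.le y) x)
            (Continuous.intervalIntegrable (by fun_prop) _ _)
      _ = ∫ s in (0 : ℝ)..t, K ^ (n + 1) * M * (s ^ n / n.factorial) := by
          refine intervalIntegral.integral_congr fun s _ => ?_
          simp only [mul_pow]
          ring
      _ = (K * t) ^ (n + 1) / (n + 1).factorial * M := by
          rw [intervalIntegral.integral_const_mul, integral_pow_div_factorial]
          ring

theorem tendsto_heatTaylor (hD : SupNormLE D K) (hu : ∀ t x, |u t x| ≤ M)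
    (hint : ∀ t x, IntervalIntegrable (fun s => D (u s) x) volume 0 t)
    (heq : ∀ t, 0 ≤ t → ∀ x, u t x = u₀ x + ∫ s in (0 : ℝ)..t, D (u s) x)
    {t : ℝ} (ht : 0 ≤ t) (x : X) :
    Tendsto (fun n => heatTaylor D u₀ n t x) atTop (𝓝 (u t x)) := by
  have bound_tendsto : Tendsto (fun n : ℕ => (K * t) ^ n / n.factorial * M) atTop (𝓝 0) := by
    simpa only [zero_mul] using
      (FloorSemiring.tendsto_pow_div_factorial_atTop (K * t)).mul_const M
  have remainder_tendsto := squeeze_zero_norm (f := fun n => u t x - heatTaylor D u₀ n t x)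
    (fun n => abs_sub_heatTaylor_le hD hu hint heq n ht x) bound_tendsto
  simpa only [sub_sub_cancel, sub_zero] using
    (tendsto_const_nhds (x := u t x)).sub remainder_tendsto

theorem pow_div_factorial_smul_sub_one_pow (A : Module.End ℝ (X → ℝ)) (t : ℝ) (m : ℕ) :
    (t ^ m / m.factorial) • (A - 1) ^ m = ∑ ij ∈ Finset.HasAntidiagonal.antidiagonal m,
      ((-t) ^ ij.2 / ij.2.factorial) • (t ^ ij.1 / ij.1.factorial) • A ^ ij.1 := by
  have hc : Commute A (-1) := (Commute.one_right A).neg_right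
  rw [sub_eq_add_neg, hc.add_pow', Finset.smul_sum]
  refine Finset.sum_congr rfl fun ij hij => ?_
  obtain rfl := Finset.HasAntidiagonal.mem_antidiagonal.1 hij
  have neg_one_pow : (-1 : Module.End ℝ (X → ℝ)) ^ ij.2 = (-1 : ℝ) ^ ij.2 • 1 := by
    rw [← neg_one_smul ℝ (1 : Module.End ℝ (X → ℝ)), smul_pow, one_pow]
  rw [neg_one_pow, mul_smul_comm, mul_one, ← Nat.cast_smul_eq_nsmul ℝ, smul_smul, smul_smul,
    smul_smul, Nat.cast_add_choose, neg_pow t, pow_add]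
  congr 1
  field_simp

theorem summable_norm_pow_div_factorial_mul_pow (hA : SupNormLE A 1) (hu₀ : ∀ x, |u₀ x| ≤ M)
    (t : ℝ) (x : X) : Summable fun m : ℕ => ‖t ^ m / m.factorial * (A ^ m) u₀ x‖ := by
  refine Summable.of_nonneg_of_le (fun _ => norm_nonneg _) (fun m => ?_)
    ((Real.summable_pow_div_factorial |t|).mul_right M)
  rw [norm_mul, norm_div, norm_pow, Real.norm_natCast]
  gcongr
  · exact le_rfl
  · exact hA.abs_pow_apply_le hu₀ m x

theorem hasSum_sub_one_pow (hA : SupNormLE A 1) (hu₀ : ∀ x, |u₀ x| ≤ M) (t : ℝ) (x : X) :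
    HasSum (fun m : ℕ => t ^ m / m.factorial * ((A - 1) ^ m) u₀ x)
      (∑' m : ℕ, Real.exp (-t) * t ^ m / m.factorial * (A ^ m) u₀ x) := by
  have summable_A := summable_norm_pow_div_factorial_mul_pow hA hu₀ t x
  have summable_exp : Summable fun m : ℕ => ‖(-t) ^ m / (m.factorial : ℝ)‖ :=
    (Real.summable_pow_div_factorial (-t)).norm
  have cauchy_product : ∀ m : ℕ, t ^ m / m.factorial * ((A - 1) ^ m) u₀ x =
      ∑ ij ∈ Finset.HasAntidiagonal.antidiagonal m,
        (t ^ ij.1 / ij.1.factorial * (A ^ ij.1) u₀ x) * ((-t) ^ ij.2 / ij.2.factorial) := by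
    intro m
    have h := congrFun (LinearMap.congr_fun (pow_div_factorial_smul_sub_one_pow A t m) u₀) x
    simpa only [LinearMap.smul_apply, LinearMap.sum_apply, Finset.sum_apply, Pi.smul_apply,
      smul_eq_mul, mul_comm] using h
  have value : ∑' m : ℕ, Real.exp (-t) * t ^ m / m.factorial * (A ^ m) u₀ x =
      (∑' m : ℕ, t ^ m / m.factorial * (A ^ m) u₀ x) * ∑' m : ℕ, (-t) ^ m / m.factorial := by
    rw [Real.exp_eq_exp_ℝ, NormedSpace.exp_eq_tsum_div, mul_comm, ← tsum_mul_left]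
    simp only [mul_div_assoc, mul_assoc]
  simp only [cauchy_product]
  rw [value, tsum_mul_tsum_eq_tsum_sum_antidiagonal_of_summable_norm summable_A summable_exp]
  exact (summable_norm_sum_mul_antidiagonal_of_summable_norm summable_A
    summable_exp).of_norm.hasSum

/-- Both sides are the sum of the Taylor series of `e^{t(A - 1)} u₀`. -/
theorem heat_eq_integral_poissonMeasure (hA : SupNormLE A 1) (hu : ∀ t x, |u t x| ≤ M)
    (hint : ∀ t x, IntervalIntegrable (fun s => (A - 1) (u s) x) volume 0 t)
    (heq : ∀ t, 0 ≤ t → ∀ x, u t x = u₀ x + ∫ s in (0 : ℝ)..t, (A - 1) (u s) x)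
    (t : ℝ≥0) (x : X) :
    u t x = ∫ m, (A ^ m) u₀ x ∂(poissonMeasure t) := by
  have hu₀ : ∀ x, |u₀ x| ≤ M := fun x => by
    simpa only [heq 0 le_rfl x, intervalIntegral.integral_same, add_zero] using hu 0 x
  rw [integral_poissonMeasure]
  refine tendsto_nhds_unique (tendsto_heatTaylor hA.sub_one hu hint heq t.2 x) ?_
  simp only [heatTaylor_apply]
  exact (hasSum_sub_one_pow hA hu₀ t x).tendsto_sum_nat

end Heat

/-! ### The particle density of the exclusion process -/

section Occupation

variable {d : ℕ} (η : Config d) (x y : Site d)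

theorem occ_nonneg : 0 ≤ occ η x := by
  unfold occ
  split_ifs <;> norm_num

theorem abs_occ_le_one : |occ η x| ≤ 1 := by
  unfold occ
  split_ifs <;> norm_num

theorem occ_mul_self : occ η x * occ η x = occ η x := by
  unfold occ
  split_ifs <;> norm_num

theorem occ_exchange (z : Site d) : occ (exchange η x y) z = occ η (Equiv.swap x y z) := rfl

theorem dependsOn_occ : DependsOn (fun η : Config d => occ η x) {x} := by
  intro η₁ η₂ h
  simp only [occ, h x rfl]

theorem continuous_occ : Continuous fun η : Config d => occ η x :=
  (continuous_of_discreteTopology (f := fun b : Bool => if b = true then (1 : ℝ) else 0)).comp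
    (continuous_apply x)

theorem measurable_occ : Measurable fun η : Config d => occ η x :=
  (measurable_of_countable fun b : Bool => if b = true then (1 : ℝ) else 0).comp
    (measurable_pi_apply x)

variable {e : Site d}

theorem hasSum_exclusion_edge (he : e ≠ 0) :
    HasSum (fun y : Site d => occ η y * (1 - occ η (y + e)) *
      (occ (exchange η y (y + e)) x - occ η x))
      (occ η (x - e) * (1 - occ η x) - occ η x * (1 - occ η (x + e))) := by
  have hne : x ≠ x - e := fun h => he (sub_eq_self.1 h.symm)
  have unaffected : ∀ y ∉ ({x, x - e} : Finset (Site d)),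
      occ η y * (1 - occ η (y + e)) * (occ (exchange η y (y + e)) x - occ η x) = 0 := by
    intro y hy
    simp only [Finset.mem_insert, Finset.mem_singleton, not_or] at hy
    have hye : x ≠ y + e := fun h => hy.2 (by rw [h, add_sub_cancel_right])
    rw [occ_exchange, Equiv.swap_apply_of_ne_of_ne (Ne.symm hy.1) hye, sub_self, mul_zero]
  convert hasSum_sum_of_ne_finset_zero (L := .unconditional _) unaffected using 1
  rw [Finset.sum_pair hne]
  simp only [occ_exchange, sub_add_cancel, Equiv.swap_apply_left, Equiv.swap_apply_right]
  linear_combination (1 - occ η (x + e)) * occ_mul_self η x +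
    occ η x * occ_mul_self η (x + e) - (1 - occ η x) * occ_mul_self η (x - e) -
    occ η (x - e) * occ_mul_self η x

/-- Exclusion is not felt by a single occupation variable: the two directions of an edge add up
to a difference that is linear in `η`. -/
theorem exclusionGenerator_occ (hd : 1 ≤ d) :
    exclusionGenerator d (fun η => occ η x) η = (latticeStep ℝ d - 1) (occ η) x := by
  have rate_sum := hasSum_sum (s := Finset.univ) fun (i : Fin d) _ =>
    hasSum_sum (s := ({1, -1} : Finset ℤ)) fun s hs =>
      hasSum_exclusion_edge η x (e := Pi.single i s) (by
        rw [Pi.single_ne_zero_iff]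
        rintro rfl
        simp at hs)
  have hd' : (d : ℝ) ≠ 0 := by positivity
  have pair : ∀ i : Fin d, ∑ s ∈ ({1, -1} : Finset ℤ),
      (occ η (x - Pi.single i s) * (1 - occ η x) - occ η x * (1 - occ η (x + Pi.single i s))) =
      ∑ s ∈ ({1, -1} : Finset ℤ), occ η (x + Pi.single i s) - 2 * occ η x := by
    intro i
    rw [Finset.sum_pair (by norm_num), Finset.sum_pair (by norm_num), Pi.single_neg,
      sub_neg_eq_add, ← sub_eq_add_neg]
    ring
  rw [exclusionGenerator, rate_sum.tsum_eq, Finset.sum_congr rfl fun i _ => pair i,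
    Finset.sum_sub_distrib, Finset.sum_const, Finset.card_univ, Fintype.card_fin, nsmul_eq_mul,
    LinearMap.sub_apply, Pi.sub_apply, latticeStep_apply, Module.End.one_apply]
  field_simp

end Occupation

section LatticeLaplacian

variable {d : ℕ} {Ω : Type*} [MeasurableSpace Ω] {f : Ω → Site d → ℝ}

theorem supNormLE_latticeStep (hd : 1 ≤ d) : SupNormLE (latticeStep ℝ d) 1 := by
  intro f c hf x
  have hd' : (d : ℝ) ≠ 0 := by positivity
  rw [latticeStep_apply, abs_mul, abs_of_nonneg (by positivity)]
  calc (2 * (d : ℝ))⁻¹ * |∑ i, ∑ s ∈ ({1, -1} : Finset ℤ), f (x + Pi.single i s)|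
      ≤ (2 * (d : ℝ))⁻¹ * ∑ _i : Fin d, ∑ _s ∈ ({1, -1} : Finset ℤ), c := by
        gcongr
        exact (Finset.abs_sum_le_sum_abs _ _).trans <| Finset.sum_le_sum fun i _ =>
          (Finset.abs_sum_le_sum_abs _ _).trans <| Finset.sum_le_sum fun s _ => hf _
    _ = 1 * c := by
        simp only [Finset.sum_const, Finset.card_univ, Fintype.card_fin, nsmul_eq_mul,
          Finset.card_pair (show (1 : ℤ) ≠ -1 by norm_num)]
        push_cast
        field_simp

theorem measurable_latticeStep_sub_one (hf : ∀ y, Measurable fun ω => f ω y) (x : Site d) :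
    Measurable fun ω => (latticeStep ℝ d - 1) (f ω) x := by
  simp only [LinearMap.sub_apply, Pi.sub_apply, Module.End.one_apply, latticeStep_apply]
  fun_prop

theorem integral_latticeStep_sub_one {P : Measure Ω} (hf : ∀ y, Integrable (fun ω => f ω y) P)
    (x : Site d) : ∫ ω, (latticeStep ℝ d - 1) (f ω) x ∂P =
      (latticeStep ℝ d - 1) (fun y => ∫ ω, f ω y ∂P) x := by
  simp only [LinearMap.sub_apply, Pi.sub_apply, Module.End.one_apply, latticeStep_apply]
  have inner_integrable : ∀ i, Integrable
      (fun ω => ∑ s ∈ ({1, -1} : Finset ℤ), f ω (x + Pi.single i s)) P :=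
    fun i => integrable_finsetSum _ fun s _ => hf _
  rw [integral_sub ((integrable_finsetSum _ fun i _ => inner_integrable i).const_mul _) (hf x),
    integral_const_mul, integral_finsetSum _ fun i _ => inner_integrable i]
  simp only [integral_finsetSum _ fun _ _ => hf _]

end LatticeLaplacian

section RightContinuous

theorem tendsto_ceil_mul_div_right (s : ℝ≥0) :
    Tendsto (fun n : ℕ => (⌈(s : ℝ) * (n + 1)⌉₊ : ℝ≥0) / (n + 1)) atTop (𝓝[≥] s) := by
  refine tendsto_nhdsWithin_iff.2 ⟨?_, Eventually.of_forall fun n => ?_⟩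
  · rw [← NNReal.tendsto_coe]
    exact (tendsto_nat_ceil_mul_div_atTop s.2).comp
      (tendsto_atTop_add_const_right _ _ tendsto_natCast_atTop_atTop)
  · rw [mem_Ici, le_div_iff₀ (by positivity)]
    exact_mod_cast Nat.le_ceil ((s : ℝ) * (n + 1))

theorem measurable_uncurry_of_continuousWithinAt_Ici {Ω E : Type*} [MeasurableSpace Ω]
    [TopologicalSpace E] [TopologicalSpace.PseudoMetrizableSpace E] [MeasurableSpace E]
    [BorelSpace E] {X : ℝ≥0 → Ω → E} (hX : ∀ t, Measurable (X t))
    (right_cont : ∀ ω t, ContinuousWithinAt (fun s => X s ω) (Ici t) t) :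
    Measurable (Function.uncurry X) := by
  have step_measurable : ∀ n : ℕ, Measurable fun p : ℝ≥0 × Ω =>
      X (⌈(p.1 : ℝ) * (n + 1)⌉₊ / (n + 1)) p.2 := by
    intro n
    have grid_measurable : Measurable fun q : ℕ × Ω => X (q.1 / (n + 1)) q.2 :=
      measurable_from_prod_countable_right fun k => hX (k / (n + 1))
    exact grid_measurable.comp (f := fun p : ℝ≥0 × Ω => (⌈(p.1 : ℝ) * (n + 1)⌉₊, p.2))
      (by fun_prop)
  exact measurable_of_tendsto_metrizable step_measurable <| tendsto_pi_nhds.2 fun p =>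
    (right_cont p.2 p.1).tendsto.comp (tendsto_ceil_mul_div_right p.1)

end RightContinuous

section Density

variable {d : ℕ} {Ω : Type*} [MeasurableSpace Ω] {P : Measure Ω} {η : ℝ≥0 → Ω → Config d}
  {η₀ : Config d}

/-- The particle density `E[η_t(x)]`, with real time `t` so that it fits the heat equation. -/
noncomputable def density (P : Measure Ω) (η : ℝ≥0 → Ω → Config d) (t : ℝ) (x : Site d) : ℝ :=
  ∫ ω, occ (η t.toNNReal ω) x ∂P

namespace IsExclusionProcess

theorem measurable_occ (hη : IsExclusionProcess d P η η₀) (x : Site d) :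
    Measurable fun p : ℝ × Ω => occ (η p.1.toNNReal p.2) x :=
  (measurable_uncurry_of_continuousWithinAt_Ici (X := fun t ω => occ (η t ω) x)
    (fun t => (_root_.measurable_occ x).comp (hη.measurable t))
    fun ω t => (continuous_occ x).continuousAt.comp_continuousWithinAt
      (hη.right_cont ω t)).comp (f := fun p : ℝ × Ω => (p.1.toNNReal, p.2)) (by fun_prop)

theorem measurable_latticeLaplacian (hη : IsExclusionProcess d P η η₀) (x : Site d) :
    Measurable fun p : ℝ × Ω => (latticeStep ℝ d - 1) (occ (η p.1.toNNReal p.2)) x :=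
  measurable_latticeStep_sub_one hη.measurable_occ x

variable [IsProbabilityMeasure P]

theorem integrable_occ (hη : IsExclusionProcess d P η η₀) (t : ℝ≥0) (x : Site d) :
    Integrable (fun ω => occ (η t ω) x) P :=
  Integrable.of_bound ((_root_.measurable_occ x).comp (hη.measurable t)).aestronglyMeasurable 1
    (ae_of_all _ fun _ => abs_occ_le_one _ _)

theorem integrable_latticeLaplacian (hη : IsExclusionProcess d P η η₀) (hd : 1 ≤ d) (t : ℝ)
    (x : Site d) : Integrable (fun p : ℝ × Ω =>
      (latticeStep ℝ d - 1) (occ (η p.1.toNNReal p.2)) x)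
      ((volume.restrict (uIoc 0 t)).prod P) :=
  have : IsFiniteMeasure (volume.restrict (uIoc 0 t)) := by
    rw [uIoc]
    infer_instance
  Integrable.of_bound (hη.measurable_latticeLaplacian x).aestronglyMeasurable (2 * 1)
    (ae_of_all _ fun _ => (supNormLE_latticeStep hd).sub_one _ _ (abs_occ_le_one _) x)

theorem density_sub_eq_integral (hη : IsExclusionProcess d P η η₀) (hd : 1 ≤ d) {t : ℝ} (ht : 0 ≤ t)
    (x : Site d) : density P η t x - occ η₀ x =
      ∫ ω, (∫ s in (0 : ℝ)..t, (latticeStep ℝ d - 1) (occ (η s.toNNReal ω)) x) ∂P := by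
  have mean_const := (hη.martingale (fun η => occ η x) {x} (by
    rw [Finset.coe_singleton]
    exact dependsOn_occ x)).setIntegral_eq (zero_le (a := t.toNNReal)) MeasurableSet.univ
  simp only [Measure.restrict_univ, sub_self, NNReal.coe_zero, intervalIntegral.integral_same,
    integral_zero, exclusionGenerator_occ _ x hd, Real.coe_toNNReal t ht] at mean_const
  have drift_integrable : Integrable (fun ω => ∫ s in (0 : ℝ)..t,
      (latticeStep ℝ d - 1) (occ (η s.toNNReal ω)) x) P := by
    have h := (hη.integrable_latticeLaplacian hd t x).integral_prod_right
    simpa only [uIoc_of_le ht, intervalIntegral.integral_of_le ht] using h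
  have initial_density : ∫ ω, occ (η 0 ω) x ∂P = occ η₀ x := by
    rw [integral_congr_ae (hη.initial.mono fun ω hω => by rw [hω]), integral_const, probReal_univ,
      one_smul]
  have increment_integrable : Integrable (fun ω => occ (η t.toNNReal ω) x - occ (η 0 ω) x) P :=
    (hη.integrable_occ _ x).sub (hη.integrable_occ _ x)
  rw [integral_sub increment_integrable drift_integrable,
    integral_sub (hη.integrable_occ _ x) (hη.integrable_occ _ x), initial_density] at mean_const
  exact sub_eq_zero.1 mean_const.symm

theorem density_eq_add_integral (hη : IsExclusionProcess d P η η₀) (hd : 1 ≤ d) {t : ℝ}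
    (ht : 0 ≤ t) (x : Site d) : density P η t x =
      occ η₀ x + ∫ s in (0 : ℝ)..t, (latticeStep ℝ d - 1) (density P η s) x := by
  have fubini : ∫ ω, (∫ s in (0 : ℝ)..t, (latticeStep ℝ d - 1) (occ (η s.toNNReal ω)) x) ∂P =
      ∫ s in (0 : ℝ)..t, (∫ ω, (latticeStep ℝ d - 1) (occ (η s.toNNReal ω)) x ∂P) :=
    (intervalIntegral_integral_swap (hη.integrable_latticeLaplacian hd t x)).symm
  rw [← sub_eq_iff_eq_add', hη.density_sub_eq_integral hd ht x, fubini]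
  simp only [integral_latticeStep_sub_one (hη.integrable_occ _)]
  rfl

theorem intervalIntegrable_latticeLaplacian_density (hη : IsExclusionProcess d P η η₀)
    (hd : 1 ≤ d) (t : ℝ) (x : Site d) :
    IntervalIntegrable (fun s => (latticeStep ℝ d - 1) (density P η s) x) volume 0 t := by
  rw [intervalIntegrable_iff]
  have h := (hη.integrable_latticeLaplacian hd t x).integral_prod_left
  simp only [integral_latticeStep_sub_one (hη.integrable_occ _)] at h
  exact h

theorem abs_density_le_one (t : ℝ) (x : Site d) : |density P η t x| ≤ 1 := by
  simpa only [density, probReal_univ, mul_one, Real.norm_eq_abs] using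
    norm_integral_le_of_norm_le_const (μ := P) (f := fun ω => occ (η t.toNNReal ω) x)
      (ae_of_all _ fun _ => abs_occ_le_one _ _)

/-- The density of the exclusion process is that of independent random walks. -/
theorem lintegral_occ (hη : IsExclusionProcess d P η η₀) (hd : 1 ≤ d) (t : ℝ≥0) (x : Site d) :
    ∫⁻ ω, ENNReal.ofReal (occ (η t ω) x) ∂P =
      ∫⁻ m, (latticeStep ℝ≥0∞ d ^ m) (fun y => ENNReal.ofReal (occ η₀ y)) x
        ∂(poissonMeasure t) := by
  have heat := heat_eq_integral_poissonMeasure (supNormLE_latticeStep hd)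
    (fun t x => abs_density_le_one (P := P) (η := η) t x)
    (hη.intervalIntegrable_latticeLaplacian_density hd)
    (fun t ht x => hη.density_eq_add_integral hd ht x) t x
  have walk_integrable : Integrable (fun m => (latticeStep ℝ d ^ m) (occ η₀) x)
      (poissonMeasure t) :=
    Integrable.of_bound (by fun_prop) 1 (ae_of_all _ fun m =>
      (supNormLE_latticeStep hd).abs_pow_apply_le (abs_occ_le_one η₀) m x)
  rw [density, Real.toNNReal_coe] at heat
  rw [← ofReal_integral_eq_lintegral_ofReal (hη.integrable_occ t x)
      (ae_of_all _ fun _ => occ_nonneg _ _), heat,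
    ofReal_integral_eq_lintegral_ofReal walk_integrable
      (ae_of_all _ fun m => latticeStep_pow_nonneg (occ_nonneg η₀) m x)]
  simp only [ofReal_latticeStep_pow hd (occ_nonneg η₀)]

end IsExclusionProcess

end Density

/-! ### Counting the particles of the initial profile -/

section Layers

variable {n : ℕ} {g : Fin n → ℝ → ℝ}

/-- The lattice points of the box `∏ i, [-g i u, g i u]`, the layer of the initial profile whose
first coordinate is `-u`. -/
noncomputable def layer (g : Fin n → ℝ → ℝ) (u : ℝ) : Finset (Fin n → ℤ) :=
  Fintype.piFinset fun i => Finset.Icc (-⌊g i u⌋) ⌊g i u⌋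

/-- The number of points of `layer g u` if all `g i u` are nonnegative. -/
noncomputable def layerCount (g : Fin n → ℝ → ℝ) (u : ℝ) : ℝ := ∏ i, (2 * (⌊g i u⌋ : ℝ) + 1)

/-- The number of particles of the initial profile with first coordinate larger than `-w`, if all
`g i` are nonnegative. -/
noncomputable def layerSum (g : Fin n → ℝ → ℝ) (w : ℝ) : ℝ :=
  ∑ j ∈ Finset.range ⌈w⌉₊, layerCount g (j : ℕ)

theorem mem_layer {u : ℝ} {y : Fin n → ℤ} : y ∈ layer g u ↔ ∀ i, |(y i : ℝ)| ≤ g i u := by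
  simp only [layer, Fintype.mem_piFinset, Finset.mem_Icc]
  exact forall_congr' fun i => by rw [← abs_le, Int.le_floor, Int.cast_abs]

theorem one_le_two_mul_floor_add_one {a : ℝ} (ha : 0 ≤ a) : 1 ≤ 2 * (⌊a⌋ : ℝ) + 1 := by
  have : (0 : ℝ) ≤ ⌊a⌋ := by exact_mod_cast Int.floor_nonneg.2 ha
  linarith

theorem layerCount_nonneg {u : ℝ} (hg : ∀ i, 0 ≤ g i u) : 0 ≤ layerCount g u :=
  Finset.prod_nonneg fun i _ => zero_le_one.trans (one_le_two_mul_floor_add_one (hg i))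

theorem card_layer {u : ℝ} (hg : ∀ i, 0 ≤ g i u) : ((layer g u).card : ℝ) = layerCount g u := by
  rw [layer, Fintype.card_piFinset, layerCount, Nat.cast_prod]
  refine Finset.prod_congr rfl fun i _ => ?_
  have floor_nonneg : 0 ≤ ⌊g i u⌋ := Int.floor_nonneg.2 (hg i)
  rw [Int.card_Icc, ← Int.cast_natCast, Int.toNat_of_nonneg (by lia)]
  push_cast
  ring

theorem occ_shapeProfile_cons (m : ℤ) (y : Fin n → ℤ) :
    occ (shapeProfile g) (Fin.cons m y) = if m ≤ 0 ∧ y ∈ layer g (-m) then 1 else 0 := by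
  simp [occ, shapeProfile, mem_layer]

theorem tsum_occ_shapeProfile_cons (hg : ∀ i, ∀ u, 0 ≤ u → 0 ≤ g i u) (m : ℤ) :
    ∑' y : Fin n → ℤ, ENNReal.ofReal (occ (shapeProfile g) (Fin.cons m y)) =
      if m ≤ 0 then ENNReal.ofReal (layerCount g (-m)) else 0 := by
  simp only [occ_shapeProfile_cons, apply_ite ENNReal.ofReal, ENNReal.ofReal_one,
    ENNReal.ofReal_zero]
  split_ifs with hm
  · have hu : (0 : ℝ) ≤ -m := by exact_mod_cast neg_nonneg.2 hm
    simp only [hm, true_and]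
    rw [tsum_eq_sum (s := layer g (-m)) fun y hy => if_neg hy, Finset.sum_ite_mem,
      Finset.inter_self, Finset.sum_const, nsmul_one, ← card_layer fun i => hg i _ hu,
      ENNReal.ofReal_natCast]
  · simp only [hm, false_and, if_false, tsum_zero]

theorem tsum_mul_occ_shapeProfile (hg : ∀ i, ∀ u, 0 ≤ u → 0 ≤ g i u) (φ : ℤ → ℝ≥0∞) :
    ∑' x : Site (n + 1), φ (x 0) * ENNReal.ofReal (occ (shapeProfile g) x) =
      ∑' j : ℕ, φ (-j) * ENNReal.ofReal (layerCount g j) := by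
  have layer_sum : ∀ m : ℤ, ∑' y : Fin n → ℤ,
      φ m * ENNReal.ofReal (occ (shapeProfile g) (Fin.cons m y)) =
        φ m * if m ≤ 0 then ENNReal.ofReal (layerCount g (-m)) else 0 := fun m => by
    rw [ENNReal.tsum_mul_left, tsum_occ_shapeProfile_cons hg]
  have neg_injective : Function.Injective fun j : ℕ => -(j : ℤ) :=
    neg_injective.comp Nat.cast_injective
  rw [← (Fin.consEquiv fun _ : Fin (n + 1) => ℤ).tsum_eq, ENNReal.tsum_prod']
  refine (tsum_congr layer_sum).trans ?_
  rw [← neg_injective.tsum_eq]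
  · simp
  · intro m hm
    have hm_nonpos : m ≤ 0 := by
      by_contra h
      simp [h] at hm
    exact ⟨m.natAbs, by simp only; lia⟩

theorem tsum_occ_shapeProfile_beyond (hg : ∀ i, ∀ u, 0 ≤ u → 0 ≤ g i u) (z : ℝ) (k : ℤ) :
    ∑' x : Site (n + 1), {l : ℤ | z < l}.indicator 1 (x 0 + k) *
      ENNReal.ofReal (occ (shapeProfile g) x) = ENNReal.ofReal (layerSum g (k - z)) := by
  have beyond_iff : ∀ j : ℕ, -(j : ℤ) + k ∈ {l : ℤ | z < l} ↔ j < ⌈k - z⌉₊ := by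
    intro j
    rw [Nat.lt_ceil, lt_sub_comm, mem_ofPred_eq, Int.cast_add, Int.cast_neg, Int.cast_natCast,
      neg_add_eq_sub]
  rw [tsum_mul_occ_shapeProfile hg fun l => {l : ℤ | z < l}.indicator 1 (l + k), layerSum,
    ENNReal.ofReal_sum_of_nonneg fun j _ => layerCount_nonneg fun i => hg i _ j.cast_nonneg,
    tsum_eq_sum (s := Finset.range ⌈k - z⌉₊)]
  · refine Finset.sum_congr rfl fun j hj => ?_
    rw [indicator_of_mem ((beyond_iff j).2 (Finset.mem_range.1 hj)), Pi.one_apply, one_mul]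
  · intro j hj
    rw [indicator_of_notMem (mt (beyond_iff j).1 (mt Finset.mem_range.2 hj)), zero_mul]

theorem lintegral_numBeyond (hg : ∀ i, ∀ u, 0 ≤ u → 0 ≤ g i u) {Ω : Type*} [MeasurableSpace Ω]
    {P : Measure Ω} [IsProbabilityMeasure P] {η : ℝ≥0 → Ω → Config (n + 1)}
    (hη : IsExclusionProcess (n + 1) P η (shapeProfile g)) (t : ℝ≥0) (z : ℝ) :
    ∫⁻ ω, numBeyond (η t ω) z ∂P =
      ∫⁻ k, ENNReal.ofReal (layerSum g (k - z)) ∂(srwLaw (t / (n + 1 : ℕ))) := by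
  have tsum_beyond (F : Site (n + 1) → ℝ≥0∞) :
      ∑' x : {x : Site (n + 1) // z < (x 0 : ℝ)}, F x =
        ∑' x, {l : ℤ | z < l}.indicator 1 (x 0) * F x := by
    refine (tsum_subtype {x : Site (n + 1) | z < (x 0 : ℝ)} F).trans (tsum_congr fun x => ?_)
    by_cases hx : z < (x 0 : ℝ) <;> simp [indicator, hx]
  calc ∫⁻ ω, numBeyond (η t ω) z ∂P
      = ∑' x : {x : Site (n + 1) // z < (x 0 : ℝ)}, ∫⁻ ω, ENNReal.ofReal (occ (η t ω) x) ∂P :=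
        lintegral_tsum fun x =>
          ((measurable_occ x.1).comp (hη.measurable t)).ennreal_ofReal.aemeasurable
    _ = ∑' x : Site (n + 1), {l : ℤ | z < l}.indicator 1 (x 0) *
          ∫⁻ m, (latticeStep ℝ≥0∞ (n + 1) ^ m)
            (fun y => ENNReal.ofReal (occ (shapeProfile g) y)) x ∂(poissonMeasure t) := by
        simp only [← hη.lintegral_occ (Nat.le_add_left 1 n)]
        exact tsum_beyond fun x => ∫⁻ ω, ENNReal.ofReal (occ (η t ω) x) ∂P
    _ = ∑' x : Site (n + 1), ∫⁻ k, {l : ℤ | z < l}.indicator 1 (x 0 + k) *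
          ENNReal.ofReal (occ (shapeProfile g) x) ∂(srwLaw (t / (n + 1 : ℕ))) := by
        rw [tsum_mul_lintegral_latticeStep_pow]
        simp only [lintegral_mul_const _ (measurable_of_countable _)]
    _ = ∫⁻ k, ENNReal.ofReal (layerSum g (k - z)) ∂(srwLaw (t / (n + 1 : ℕ))) := by
        rw [← lintegral_tsum fun x => (measurable_of_countable _).aemeasurable]
        simp only [tsum_occ_shapeProfile_beyond hg]

end Layers

/-! ### Comparison of the layer sums with integrals -/

section SumIntegral

variable {h : ℝ → ℝ} {a b w : ℝ}

theorem nonneg_of_monotoneOn_Ici (hm : MonotoneOn h (Ici 0)) (h0 : 0 ≤ h 0) (ha : 0 ≤ a) :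
    0 ≤ h a := h0.trans (hm self_mem_Ici ha ha)

theorem intervalIntegrable_of_monotoneOn_Ici (hm : MonotoneOn h (Ici 0)) (ha : 0 ≤ a)
    (hb : 0 ≤ b) : IntervalIntegrable h volume a b :=
  (hm.mono fun _ hx => (le_min ha hb).trans hx.1).intervalIntegrable

theorem integral_mono_right (hm : MonotoneOn h (Ici 0)) (h0 : 0 ≤ h 0) (ha : 0 ≤ a)
    (hab : a ≤ b) : ∫ u in (0 : ℝ)..a, h u ≤ ∫ u in (0 : ℝ)..b, h u :=
  intervalIntegral.integral_mono_interval le_rfl ha hab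
    (ae_restrict_of_forall_mem measurableSet_Ioc fun _ hu =>
      nonneg_of_monotoneOn_Ici hm h0 hu.1.le)
    (intervalIntegrable_of_monotoneOn_Ici hm le_rfl (ha.trans hab))

theorem integral_sub_integral_le (hm : MonotoneOn h (Ici 0)) (ha : 0 ≤ a) (hab : a ≤ b) :
    (∫ u in (0 : ℝ)..b, h u) - ∫ u in (0 : ℝ)..a, h u ≤ (b - a) * h b := by
  have hb := ha.trans hab
  rw [intervalIntegral.integral_interval_sub_left
    (intervalIntegrable_of_monotoneOn_Ici hm le_rfl hb)
    (intervalIntegrable_of_monotoneOn_Ici hm le_rfl ha), ← smul_eq_mul,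
    ← intervalIntegral.integral_const]
  exact intervalIntegral.integral_mono_on hab (intervalIntegrable_of_monotoneOn_Ici hm ha hb)
    intervalIntegrable_const fun u hu => hm (ha.trans hu.1) hb hu.2

theorem exists_ceil_eq_add_one (hw : 0 < w) : ∃ m : ℕ, ⌈w⌉₊ = m + 1 ∧ m ≤ w ∧ w ≤ m + 1 := by
  obtain ⟨m, hm⟩ := Nat.exists_eq_add_one_of_ne_zero (Nat.ceil_pos.2 hw).ne'
  exact ⟨m, hm, (Nat.lt_ceil.1 (by lia)).le, by exact_mod_cast hm ▸ Nat.le_ceil w⟩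

theorem sum_range_ceil_le_integral_add (hm : MonotoneOn h (Ici 0)) (h0 : 0 ≤ h 0) (hw : 0 < w) :
    ∑ j ∈ Finset.range ⌈w⌉₊, h j ≤ (∫ u in (0 : ℝ)..w, h u) + h w := by
  obtain ⟨m, ceil_eq, hmw, -⟩ := exists_ceil_eq_add_one hw
  have sum_le : ∑ j ∈ Finset.range m, h j ≤ ∫ u in (0 : ℝ)..m, h u := by
    simpa only [zero_add] using
      MonotoneOn.sum_le_integral (x₀ := 0) (a := m) (hm.mono Icc_subset_Ici_self)
  rw [ceil_eq, Finset.sum_range_succ]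
  exact add_le_add (sum_le.trans (integral_mono_right hm h0 m.cast_nonneg hmw))
    (hm (mem_Ici.2 m.cast_nonneg) hw.le hmw)

theorem integral_le_sum_range_ceil_add (hm : MonotoneOn h (Ici 0)) (h0 : 0 ≤ h 0) (hw : 0 < w) :
    ∫ u in (0 : ℝ)..w, h u ≤ ∑ j ∈ Finset.range ⌈w⌉₊, h j + h w := by
  obtain ⟨m, ceil_eq, hmw, hwm⟩ := exists_ceil_eq_add_one hw
  have le_sum : ∫ u in (0 : ℝ)..m, h u ≤ ∑ j ∈ Finset.range m, h (j + 1 : ℕ) := by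
    simpa only [zero_add] using
      MonotoneOn.integral_le_sum (x₀ := 0) (a := m) (hm.mono Icc_subset_Ici_self)
  have last_le : (w - m) * h w ≤ h w :=
    mul_le_of_le_one_left (nonneg_of_monotoneOn_Ici hm h0 hw.le) (by linarith)
  rw [ceil_eq, Finset.sum_range_succ', Nat.cast_zero]
  linarith [integral_sub_integral_le hm m.cast_nonneg hmw]

end SumIntegral

theorem prod_le_prod_add_sum {ι R : Type*} [DecidableEq ι] [CommRing R] [LinearOrder R]
    [IsStrictOrderedRing R] (s : Finset ι) {a b : ι → R} (hb : ∀ i ∈ s, 0 ≤ b i)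
    (hab : ∀ i ∈ s, b i ≤ a i) :
    ∏ i ∈ s, a i ≤ ∏ i ∈ s, b i + ∑ i ∈ s, (a i - b i) * ∏ l ∈ s.erase i, a l := by
  induction s using Finset.induction_on with
  | empty => simp
  | insert k s hk ih =>
    simp only [Finset.forall_mem_insert] at hb hab
    have ha : ∀ i ∈ s, 0 ≤ a i := fun i hi => (hb.2 i hi).trans (hab.2 i hi)
    have rest_le : b k * ∑ i ∈ s, (a i - b i) * ∏ l ∈ s.erase i, a l ≤
        ∑ i ∈ s, (a i - b i) * ∏ l ∈ (insert k s).erase i, a l := by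
      rw [Finset.mul_sum]
      refine Finset.sum_le_sum fun i hi => ?_
      rw [Finset.erase_insert_of_ne (ne_of_mem_of_not_mem hi hk).symm,
        Finset.prod_insert fun h => hk (Finset.mem_of_mem_erase h), mul_left_comm]
      exact mul_le_mul_of_nonneg_left (mul_le_mul_of_nonneg_right hab.1
        (Finset.prod_nonneg fun l hl => ha l (Finset.mem_of_mem_erase hl)))
        (sub_nonneg.2 (hab.2 i hi))
    rw [Finset.prod_insert hk, Finset.prod_insert hk, Finset.sum_insert hk,
      Finset.erase_insert hk]
    linarith [mul_le_mul_of_nonneg_left (ih hb.2 hab.2) hb.1]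

theorem exists_eventually_floor_eq {h : ℝ → ℝ} (hm : MonotoneOn h (Ici 0))
    (hb : BddAbove (h '' Ici 0)) : ∃ c : ℤ, ∀ᶠ u in atTop, ⌊h u⌋ = c := by
  obtain ⟨M, hM⟩ := hb
  have floor_mono : Monotone fun u => ⌊h (max u 0)⌋ := fun u v huv =>
    Int.floor_le_floor (hm (le_max_right u 0) (le_max_right v 0) (max_le_max_right 0 huv))
  have floor_bdd : BddAbove (range fun u => ⌊h (max u 0)⌋) := by
    refine ⟨⌊M⌋, ?_⟩
    rintro _ ⟨u, rfl⟩
    exact Int.floor_le_floor (hM (mem_image_of_mem h (le_max_right u 0)))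
  have eventually_const := tendsto_atTop_ciSup floor_mono floor_bdd
  rw [nhds_discrete, tendsto_pure] at eventually_const
  refine ⟨⨆ u, ⌊h (max u 0)⌋, ?_⟩
  filter_upwards [eventually_const, eventually_ge_atTop 0] with u hu hu0
  rwa [max_eq_left hu0] at hu

section LayerBounds

variable {n : ℕ} {g : Fin n → ℝ → ℝ} {A : Finset (Fin n)} {L : Fin n → ℝ} {u w : ℝ}

/-- The integrand of `hatG`, of the order of the boundary of the layer whose volume is `bigG`. -/
noncomputable def faceG (g : Fin n → ℝ → ℝ) (A : Finset (Fin n)) (u : ℝ) : ℝ :=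
  ∑ i ∈ A, bigG g (A.erase i) u

theorem one_le_bigG (hg : ∀ i, 0 ≤ g i u) : 1 ≤ bigG g A u := by
  calc (1 : ℝ) = ∏ _i ∈ A, 1 := Finset.prod_const_one.symm
    _ ≤ bigG g A u := Finset.prod_le_prod (fun _ _ => zero_le_one) fun i _ => by linarith [hg i]

theorem bigG_nonneg (hg : ∀ i, 0 ≤ g i u) : 0 ≤ bigG g A u := zero_le_one.trans (one_le_bigG hg)

theorem faceG_nonneg (hg : ∀ i, 0 ≤ g i u) : 0 ≤ faceG g A u :=
  Finset.sum_nonneg fun _ _ => bigG_nonneg hg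

theorem faceG_le (hg : ∀ i, 0 ≤ g i u) : faceG g A u ≤ A.card * bigG g A u := by
  rw [← nsmul_eq_mul, faceG]
  refine Finset.sum_le_card_nsmul A _ _ fun i hi => ?_
  rw [bigG, bigG, ← Finset.mul_prod_erase A _ hi]
  exact le_mul_of_one_le_left (bigG_nonneg hg) (by linarith [hg i])

theorem monotoneOn_bigG (hg : ∀ i, ∀ u, 0 ≤ u → 0 ≤ g i u) (hm : ∀ i, MonotoneOn (g i) (Ici 0)) :
    MonotoneOn (bigG g A) (Ici 0) := fun u hu v hv huv =>
  Finset.prod_le_prod (fun i _ => by linarith [hg i u hu]) fun i _ => by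
    linarith [hm i hu hv huv]

theorem monotoneOn_faceG (hg : ∀ i, ∀ u, 0 ≤ u → 0 ≤ g i u)
    (hm : ∀ i, MonotoneOn (g i) (Ici 0)) : MonotoneOn (faceG g A) (Ici 0) :=
  fun _ hu _ hv huv => Finset.sum_le_sum fun _ _ => monotoneOn_bigG hg hm hu hv huv

theorem hatG_nonneg (hg : ∀ i, ∀ u, 0 ≤ u → 0 ≤ g i u) (hw : 0 ≤ w) : 0 ≤ hatG g A w :=
  intervalIntegral.integral_nonneg hw fun u hu => faceG_nonneg fun i => hg i u hu.1

theorem layerCount_le (hg : ∀ i, 0 ≤ g i u) (hL : ∀ i ∈ Aᶜ, 2 * (⌊g i u⌋ : ℝ) + 1 ≤ L i) :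
    layerCount g u ≤ (∏ i ∈ Aᶜ, L i) * bigG g A u := by
  have factor_nonneg := fun i => zero_le_one.trans (one_le_two_mul_floor_add_one (hg i))
  rw [layerCount, ← Finset.prod_compl_mul_prod A]
  refine mul_le_mul (Finset.prod_le_prod (fun i _ => factor_nonneg i) hL)
    (Finset.prod_le_prod (fun i _ => factor_nonneg i) fun i _ => ?_)
    (Finset.prod_nonneg fun i _ => factor_nonneg i)
    (Finset.prod_nonneg fun i hi => (factor_nonneg i).trans (hL i hi))
  linarith [Int.floor_le (g i u)]

theorem prod_mul_bigG_le (hg : ∀ i, 0 ≤ g i u)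
    (hL : ∀ i ∈ Aᶜ, 2 * (⌊g i u⌋ : ℝ) + 1 = L i) :
    (∏ i ∈ Aᶜ, L i) * bigG g A u ≤ layerCount g u + 2 * (∏ i ∈ Aᶜ, L i) * faceG g A u := by
  have factor_nonneg := fun i => zero_le_one.trans (one_le_two_mul_floor_add_one (hg i))
  have prod_bound := prod_le_prod_add_sum A (a := fun i => 2 * g i u + 1)
    (fun i _ => factor_nonneg i) fun i _ => by linarith [Int.floor_le (g i u)]
  have rounding_le : ∑ i ∈ A, (2 * g i u + 1 - (2 * (⌊g i u⌋ : ℝ) + 1)) *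
      ∏ l ∈ A.erase i, (2 * g l u + 1) ≤ 2 * faceG g A u := by
    rw [faceG, Finset.mul_sum]
    refine Finset.sum_le_sum fun i _ => mul_le_mul_of_nonneg_right ?_ (bigG_nonneg hg)
    linarith [Int.lt_floor_add_one (g i u)]
  rw [layerCount, ← Finset.prod_compl_mul_prod A, Finset.prod_congr rfl hL, mul_comm 2, mul_assoc,
    ← mul_add]
  exact mul_le_mul_of_nonneg_left (prod_bound.trans (add_le_add_right rounding_le _))
    (Finset.prod_nonneg fun i hi => hL i hi ▸ factor_nonneg i)

theorem layerSum_le (hg : ∀ i, ∀ u, 0 ≤ u → 0 ≤ g i u) (hm : ∀ i, MonotoneOn (g i) (Ici 0))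
    (hL : ∀ i ∈ Aᶜ, ∀ u, 0 ≤ u → 2 * (⌊g i u⌋ : ℝ) + 1 ≤ L i) (hw : 0 < w) :
    layerSum g w ≤ (∏ i ∈ Aᶜ, L i) * ((∫ u in (0 : ℝ)..w, bigG g A u) + bigG g A w) := by
  calc layerSum g w
      ≤ ∑ j ∈ Finset.range ⌈w⌉₊, (∏ i ∈ Aᶜ, L i) * bigG g A (j : ℕ) :=
        Finset.sum_le_sum fun j _ => layerCount_le (fun i => hg i j j.cast_nonneg)
          fun i hi => hL i hi j j.cast_nonneg
    _ ≤ (∏ i ∈ Aᶜ, L i) * ((∫ u in (0 : ℝ)..w, bigG g A u) + bigG g A w) := by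
        rw [← Finset.mul_sum]
        exact mul_le_mul_of_nonneg_left
          (sum_range_ceil_le_integral_add (monotoneOn_bigG hg hm)
            (bigG_nonneg fun i => hg i 0 le_rfl) hw)
          (Finset.prod_nonneg fun i hi => (zero_le_one.trans
            (one_le_two_mul_floor_add_one (hg i 0 le_rfl))).trans (hL i hi 0 le_rfl))

theorem le_layerSum_add (hg : ∀ i, ∀ u, 0 ≤ u → 0 ≤ g i u) (hm : ∀ i, MonotoneOn (g i) (Ici 0))
    {N : ℕ} (hL : ∀ i ∈ Aᶜ, ∀ u, (N : ℝ) ≤ u → 2 * (⌊g i u⌋ : ℝ) + 1 = L i) (hw : 0 < w) :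
    (∏ i ∈ Aᶜ, L i) * ∫ u in (0 : ℝ)..w, bigG g A u ≤
      layerSum g w + (∏ i ∈ Aᶜ, L i) * ((N + 2 * A.card + 1) * bigG g A w + 2 * hatG g A w) := by
  have hg_w : ∀ i, 0 ≤ g i w := fun i => hg i w hw.le
  have prod_nonneg : 0 ≤ ∏ i ∈ Aᶜ, L i := Finset.prod_nonneg fun i hi =>
    hL i hi N le_rfl ▸ zero_le_one.trans (one_le_two_mul_floor_add_one (hg i N N.cast_nonneg))
  set Λ := ∏ i ∈ Aᶜ, L i
  have layer_bound : ∀ j ∈ Finset.range ⌈w⌉₊, Λ * bigG g A (j : ℕ) ≤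
      layerCount g (j : ℕ) + 2 * Λ * faceG g A (j : ℕ) +
        if j ∈ Finset.range N then Λ * bigG g A w else 0 := fun j hj => by
    have hg_j : ∀ i, 0 ≤ g i (j : ℕ) := fun i => hg i j j.cast_nonneg
    split_ifs with hjN
    · have hjw : (j : ℝ) ≤ w := (Nat.lt_ceil.1 (Finset.mem_range.1 hj)).le
      exact (mul_le_mul_of_nonneg_left
        (monotoneOn_bigG hg hm (mem_Ici.2 j.cast_nonneg) hw.le hjw) prod_nonneg).trans
        (le_add_of_nonneg_left (add_nonneg (layerCount_nonneg hg_j)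
          (mul_nonneg (mul_nonneg zero_le_two prod_nonneg) (faceG_nonneg hg_j))))
    · rw [add_zero]
      exact prod_mul_bigG_le hg_j fun i hi =>
        hL i hi j (Nat.cast_le.2 (not_lt.1 fun h => hjN (Finset.mem_range.2 h)))
  have early_sum_le : (∑ j ∈ Finset.range ⌈w⌉₊,
      if j ∈ Finset.range N then Λ * bigG g A w else 0) ≤ N * (Λ * bigG g A w) := by
    rw [← Finset.sum_filter, Finset.sum_const, nsmul_eq_mul, Finset.filter_mem_eq_inter]
    refine mul_le_mul_of_nonneg_right (Nat.cast_le.2 ?_)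
      (mul_nonneg prod_nonneg (bigG_nonneg hg_w))
    exact (Finset.card_le_card Finset.inter_subset_right).trans_eq (Finset.card_range N)
  have face_sum_le : ∑ j ∈ Finset.range ⌈w⌉₊, faceG g A (j : ℕ) ≤
      hatG g A w + A.card * bigG g A w :=
    (sum_range_ceil_le_integral_add (monotoneOn_faceG hg hm)
      (faceG_nonneg fun i => hg i 0 le_rfl) hw).trans (add_le_add_right (faceG_le hg_w) _)
  have layer_sum_le := Finset.sum_le_sum layer_bound
  simp only [Finset.sum_add_distrib, ← Finset.mul_sum] at layer_sum_le
  rw [← layerSum] at layer_sum_le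
  have integral_le := integral_le_sum_range_ceil_add (monotoneOn_bigG (A := A) hg hm)
    (bigG_nonneg fun i => hg i 0 le_rfl) hw
  linarith [mul_le_mul_of_nonneg_left integral_le prod_nonneg,
    mul_le_mul_of_nonneg_left face_sum_le prod_nonneg]

theorem exists_eventually_eq_of_bddAbove (hm : ∀ i, MonotoneOn (g i) (Ici 0))
    (hb : ∀ i ∈ Aᶜ, BddAbove (g i '' Ici 0)) :
    ∃ (L : Fin n → ℝ) (N : ℕ), ∀ i ∈ Aᶜ, ∀ u, (N : ℝ) ≤ u → 2 * (⌊g i u⌋ : ℝ) + 1 = L i := by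
  choose! c hc using fun i (hi : i ∈ Aᶜ) => exists_eventually_floor_eq (hm i) (hb i hi)
  obtain ⟨u₀, hu₀⟩ := eventually_atTop.1 ((eventually_all_finset Aᶜ).2 hc)
  refine ⟨fun i => 2 * (c i : ℝ) + 1, ⌈u₀⌉₊, fun i hi u hu => ?_⟩
  rw [hu₀ u ((Nat.le_ceil u₀).trans hu) i hi]

theorem exists_abs_layerSum_sub_le (hg : ∀ i, ∀ u, 0 ≤ u → 0 ≤ g i u)
    (hm : ∀ i, MonotoneOn (g i) (Ici 0)) (hb : ∀ i ∈ Aᶜ, BddAbove (g i '' Ici 0)) :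
    ∃ L : Fin n → ℝ,
      (∀ i ∈ Aᶜ, Tendsto (fun u : ℝ => 2 * (⌊g i u⌋ : ℝ) + 1) atTop (𝓝 (L i))) ∧
      0 ≤ ∏ i ∈ Aᶜ, L i ∧ ∃ C : ℝ, 0 < C ∧ ∀ w, 0 < w →
        |layerSum g w - (∏ i ∈ Aᶜ, L i) * ∫ u in (0 : ℝ)..w, bigG g A u| ≤
          C * (bigG g A w + hatG g A w) := by
  obtain ⟨L, N, hL⟩ := exists_eventually_eq_of_bddAbove hm hb
  have le_L : ∀ i ∈ Aᶜ, ∀ u, 0 ≤ u → 2 * (⌊g i u⌋ : ℝ) + 1 ≤ L i := fun i hi u hu => by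
    have floor_le := Int.floor_le_floor (hm i (mem_Ici.2 hu)
      (mem_Ici.2 (hu.trans (le_max_left u N))) (le_max_left u N))
    rw [← hL i hi (max u N) (le_max_right u N)]
    exact_mod_cast (by lia : 2 * ⌊g i u⌋ + 1 ≤ 2 * ⌊g i (max u N)⌋ + 1)
  have prod_nonneg : 0 ≤ ∏ i ∈ Aᶜ, L i := Finset.prod_nonneg fun i hi =>
    (zero_le_one.trans (one_le_two_mul_floor_add_one (hg i 0 le_rfl))).trans (le_L i hi 0 le_rfl)
  refine ⟨L, fun i hi => tendsto_const_nhds.congr' ?_, prod_nonneg,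
    (∏ i ∈ Aᶜ, L i) * (N + 2 * A.card + 2) + 1, by positivity, fun w hw => ?_⟩
  · filter_upwards [eventually_ge_atTop (N : ℝ)] with u hu using (hL i hi u hu).symm
  · have G_nonneg : 0 ≤ bigG g A w := bigG_nonneg fun i => hg i w hw.le
    have hatG_w_nonneg : 0 ≤ hatG g A w := hatG_nonneg hg hw.le
    set Λ := ∏ i ∈ Aᶜ, L i
    have upper : layerSum g w ≤ Λ * ((∫ u in (0 : ℝ)..w, bigG g A u) + bigG g A w) :=
      layerSum_le hg hm le_L hw
    have lower : Λ * ∫ u in (0 : ℝ)..w, bigG g A u ≤ layerSum g w +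
        Λ * ((N + 2 * A.card + 1) * bigG g A w + 2 * hatG g A w) := le_layerSum_add hg hm hL hw
    have extra_nonneg : 0 ≤ Λ * ((N + 2 * A.card) * hatG g A w) := by positivity
    have ΛG_nonneg : 0 ≤ Λ * bigG g A w := by positivity
    have spare_nonneg : 0 ≤ Λ * ((N + 2 * A.card + 1) * bigG g A w + 2 * hatG g A w) := by
      positivity
    rw [abs_sub_le_iff]
    constructor <;> linarith

end LayerBounds

section Transfer

variable {p q e h : ℝ → ℝ} {C : ℝ}

theorem lintegral_ofReal_le_add_meanBeyond (hC : 0 ≤ C) (h_eq : ∀ w ≤ 0, p w = q w)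
    (h_abs : ∀ w, 0 < w → |p w - q w| ≤ C * e w) (s : ℝ≥0) (z : ℝ) :
    ∫⁻ k : ℤ, ENNReal.ofReal (p (k - z)) ∂(srwLaw s) ≤
      ∫⁻ k : ℤ, ENNReal.ofReal (q (k - z)) ∂(srwLaw s) + ENNReal.ofReal C * meanBeyond e s z := by
  rw [meanBeyond, ← lintegral_indicator MeasurableSet.of_discrete,
    ← lintegral_const_mul _ (measurable_of_countable _),
    ← lintegral_add_left (measurable_of_countable _)]
  refine lintegral_mono fun k => ?_
  by_cases hk : z < (k : ℝ)
  · rw [indicator_of_mem (show k ∈ {k : ℤ | z < (k : ℝ)} from hk), ← ENNReal.ofReal_mul hC]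
    refine (ENNReal.ofReal_le_ofReal ?_).trans ENNReal.ofReal_add_le
    exact sub_le_iff_le_add'.1 ((le_abs_self _).trans (h_abs _ (sub_pos.2 hk)))
  · rw [h_eq _ (sub_nonpos.2 (not_lt.1 hk))]
    exact le_self_add

theorem meanBeyond_add_le (f h : ℝ → ℝ) (s : ℝ≥0) (z : ℝ) :
    meanBeyond (fun w => f w + h w) s z ≤ meanBeyond f s z + meanBeyond h s z := by
  rw [meanBeyond, meanBeyond, meanBeyond, ← lintegral_add_left (measurable_of_countable _)]
  exact lintegral_mono fun k => ENNReal.ofReal_add_le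

/-- `E₀[∫_0^{(ζ_s - z)_+} h(u) du]`, which is `meanIntG` for `h = G_A`. -/
noncomputable def meanPrimitive (h : ℝ → ℝ) (s : ℝ≥0) (z : ℝ) : ℝ≥0∞ :=
  ∫⁻ k : ℤ, ENNReal.ofReal (∫ u in (0 : ℝ)..(max ((k : ℝ) - z) 0), h u) ∂(srwLaw s)

theorem meanIntG_eq_meanPrimitive {n : ℕ} (g : Fin n → ℝ → ℝ) (A : Finset (Fin n)) (s : ℝ≥0)
    (z : ℝ) : meanIntG g A s z = meanPrimitive (bigG g A) s z := rfl

theorem ofReal_mul_meanPrimitive (hC : 0 ≤ C) (s : ℝ≥0) (z : ℝ) :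
    ENNReal.ofReal C * meanPrimitive h s z = ∫⁻ k : ℤ,
      ENNReal.ofReal (C * ∫ u in (0 : ℝ)..(max ((k : ℝ) - z) 0), h u) ∂(srwLaw s) := by
  simp_rw [ENNReal.ofReal_mul hC]
  rw [lintegral_const_mul _ (measurable_of_countable _), meanPrimitive]

end Transfer

/-! ### Finiteness of the main term -/

theorem tsum_lt_top_of_succ_le {a b : ℕ → ℝ≥0∞} {r : ℝ≥0∞} (hr : r < 1) (ha : a 0 < ⊤)
    (hb : ∑' n, b n < ⊤) (h_succ : ∀ n, a (n + 1) ≤ r * a n + b (n + 1)) : ∑' n, a n < ⊤ := by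
  have gap_ne_zero : 1 - r ≠ 0 := (tsub_pos_of_lt hr).ne'
  have gap_ne_top : 1 - r ≠ ⊤ := ENNReal.sub_ne_top ENNReal.one_ne_top
  have geometric : r * (1 - r)⁻¹ + 1 = (1 - r)⁻¹ := by
    calc r * (1 - r)⁻¹ + 1 = (r + (1 - r)) * (1 - r)⁻¹ := by
          rw [add_mul, ENNReal.mul_inv_cancel gap_ne_zero gap_ne_top]
      _ = (1 - r)⁻¹ := by rw [add_tsub_cancel_of_le hr.le, one_mul]
  have sum_le : ∀ N, ∑ n ∈ Finset.range N, a n ≤ (1 - r)⁻¹ * (a 0 + ∑' n, b n) := fun N => by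
    induction N with
    | zero => simp
    | succ N ih =>
      have sum_b_le : ∑ n ∈ Finset.range N, b (n + 1) ≤ ∑' n, b n :=
        (ENNReal.sum_le_tsum _).trans
          (ENNReal.tsum_comp_le_tsum_of_injective (add_left_injective 1) b)
      calc ∑ n ∈ Finset.range (N + 1), a n
          = ∑ n ∈ Finset.range N, a (n + 1) + a 0 := Finset.sum_range_succ' _ _
        _ ≤ r * ∑ n ∈ Finset.range N, a n + ∑ n ∈ Finset.range N, b (n + 1) + a 0 := by
            rw [Finset.mul_sum, ← Finset.sum_add_distrib]
            gcongr with n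
            exact h_succ n
        _ ≤ r * ((1 - r)⁻¹ * (a 0 + ∑' n, b n)) + ∑' n, b n + a 0 := by gcongr
        _ = (r * (1 - r)⁻¹ + 1) * (a 0 + ∑' n, b n) := by ring
        _ = (1 - r)⁻¹ * (a 0 + ∑' n, b n) := by rw [geometric]
  exact (ENNReal.tsum_le_of_sum_range_le sum_le).trans_lt
    (ENNReal.mul_lt_top (ENNReal.inv_lt_top.2 (tsub_pos_of_lt hr))
      (ENNReal.add_lt_top.2 ⟨ha, hb⟩))

theorem tsum_lt_top_of_eventually_succ_le {a b : ℕ → ℝ≥0∞} {r : ℝ≥0∞} (hr : r < 1)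
    (ha : ∀ n, a n < ⊤) (hb : ∑' n, b n < ⊤)
    (h_succ : ∀ᶠ n in atTop, a (n + 1) ≤ r * a n + b (n + 1)) : ∑' n, a n < ⊤ := by
  obtain ⟨K, hK⟩ := eventually_atTop.1 h_succ
  have tail_b_lt_top : ∑' n, b (n + K) < ⊤ :=
    (ENNReal.tsum_comp_le_tsum_of_injective (add_left_injective K) b).trans_lt hb
  have tail_a_lt_top : ∑' n, a (n + K) < ⊤ :=
    tsum_lt_top_of_succ_le hr (ha (0 + K)) tail_b_lt_top fun n => by
      rw [add_right_comm n 1 K]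
      exact hK (n + K) (Nat.le_add_left K n)
  rw [← ENNReal.summable.sum_add_tsum_nat_add' (k := K)]
  exact ENNReal.add_lt_top.2 ⟨ENNReal.sum_lt_top.2 fun n _ => ha n, tail_a_lt_top⟩

theorem eventually_srwLaw_singleton_succ_le (s : ℝ≥0) {r : ℝ≥0∞} (hr : 0 < r) :
    ∀ᶠ k : ℕ in atTop, srwLaw s {((k + 1 : ℕ) : ℤ)} ≤ r * srwLaw s {(k : ℤ)} := by
  have ratio_tendsto : Tendsto (fun k : ℕ => ENNReal.ofReal ((s * 2⁻¹ : ℝ≥0) / (k + 1))) atTop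
      (𝓝 0) := by
    simpa using ENNReal.tendsto_ofReal
      ((tendsto_const_div_atTop_nhds_zero_nat ((s * 2⁻¹ : ℝ≥0) : ℝ)).comp (tendsto_add_atTop_nat 1))
  filter_upwards [ENNReal.tendsto_nhds_zero.1 ratio_tendsto r hr] with k hk
  exact (srwLaw_singleton_succ_le s k).trans (mul_le_mul_left hk _)

theorem meanBeyond_eq_tsum (h : ℝ → ℝ) (s : ℝ≥0) (z : ℝ) :
    meanBeyond h s z =
      ∑' k : ℤ, (if z < (k : ℝ) then ENNReal.ofReal (h (k - z)) else 0) * srwLaw s {k} := by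
  rw [meanBeyond, ← lintegral_indicator MeasurableSet.of_discrete, lintegral_countable']
  rfl

theorem meanPrimitive_lt_top {h : ℝ → ℝ} (hm : MonotoneOn h (Ici 0)) {s : ℝ≥0} {z : ℝ}
    (h_fin : meanBeyond h s z < ⊤) : meanPrimitive h s z < ⊤ := by
  set F : ℤ → ℝ≥0∞ := fun k =>
    ENNReal.ofReal (∫ u in (0 : ℝ)..(max ((k : ℝ) - z) 0), h u) * srwLaw s {k}
  have F_lt_top : ∀ k, F k < ⊤ := fun k => ENNReal.mul_lt_top ENNReal.ofReal_lt_top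
    (measure_lt_top _ _)
  have F_neg_eq_zero : ∀ n ∉ Finset.range ⌈-z⌉₊, F (-(n + 1)) = 0 := fun n hn => by
    have hnz := (Nat.le_ceil (-z)).trans (Nat.cast_le.2 (not_lt.1 (hn ∘ Finset.mem_range.2)))
    simp only [F]
    rw [max_eq_right (by push_cast; linarith), intervalIntegral.integral_same,
      ENNReal.ofReal_zero, zero_mul]
  rw [meanPrimitive, lintegral_countable',
    tsum_of_nat_of_neg_add_one ENNReal.summable ENNReal.summable, tsum_eq_sum F_neg_eq_zero]
  refine ENNReal.add_lt_top.2 ⟨?_, ENNReal.sum_lt_top.2 fun n _ => F_lt_top _⟩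
  rw [meanBeyond_eq_tsum] at h_fin
  refine tsum_lt_top_of_eventually_succ_le ENNReal.one_half_lt_one (fun n => F_lt_top n)
    ((ENNReal.tsum_comp_le_tsum_of_injective Nat.cast_injective _).trans_lt h_fin) ?_
  filter_upwards [eventually_srwLaw_singleton_succ_le s (ENNReal.inv_pos.2 ENNReal.ofNat_ne_top :
      (0 : ℝ≥0∞) < 2⁻¹),
    eventually_ge_atTop ⌈z⌉₊] with k ratio_le hk
  have hw : 0 ≤ (k : ℝ) - z := sub_nonneg.2 ((Nat.le_ceil z).trans (Nat.cast_le.2 hk))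
  have primitive_succ_le := ENNReal.ofReal_le_ofReal
    (sub_le_iff_le_add'.1 (integral_sub_integral_le hm hw (le_add_of_nonneg_right zero_le_one)))
  have cast_succ : (((k + 1 : ℕ) : ℤ) : ℝ) - z = (k : ℝ) - z + 1 := by push_cast; ring
  rw [cast_succ, Int.cast_natCast, max_eq_left hw, max_eq_left (by linarith),
    if_pos (by push_cast; linarith)]
  calc _ ≤ (ENNReal.ofReal (∫ u in (0 : ℝ)..k - z, h u) + ENNReal.ofReal (h (k - z + 1))) *
          srwLaw s {((k + 1 : ℕ) : ℤ)} := by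
        rw [add_sub_cancel_left, one_mul] at primitive_succ_le
        exact mul_le_mul_left (primitive_succ_le.trans ENNReal.ofReal_add_le) _
    _ ≤ _ := by
        rw [add_mul, mul_left_comm]
        exact add_le_add_left (mul_le_mul_right ratio_le _) _

/-! ### The error vanishes in the long run -/

section Growth

open Asymptotics

variable {n : ℕ} {g : Fin n → ℝ → ℝ} {A : Finset (Fin n)}

theorem exists_le_add_mul_integral {F F' G : ℝ → ℝ} (hFm : MonotoneOn F (Ici 0))
    (hF' : ∀ u, 0 < u → HasDerivAt F (F' u) u) (hGm : MonotoneOn G (Ici 0)) (hG : 0 ≤ G 0)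
    (hFG : F' =o[atTop] G) {δ : ℝ} (hδ : 0 < δ) :
    ∃ C, ∀ w, 0 ≤ w → F w ≤ C + δ * ∫ u in (0 : ℝ)..w, G u := by
  obtain ⟨b, hb, hb_pos⟩ := ((eventually_forall_ge_atTop.2 (hFG.def hδ)).and
    (eventually_gt_atTop 0)).exists
  have integral_nonneg : ∀ w, 0 ≤ w → 0 ≤ ∫ u in (0 : ℝ)..w, G u := fun w hw =>
    intervalIntegral.integral_nonneg hw fun u hu => nonneg_of_monotoneOn_Ici hGm hG hu.1
  have integrable : ∀ w, 0 ≤ w → IntervalIntegrable G volume 0 w := fun w hw =>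
    intervalIntegrable_of_monotoneOn_Ici hGm le_rfl hw
  refine ⟨F b, fun w hw => ?_⟩
  rcases le_total w b with hwb | hbw
  · exact le_add_of_le_of_nonneg (hFm hw hb_pos.le hwb) (mul_nonneg hδ.le (integral_nonneg w hw))
  have F_sub_le : F w - F b ≤ ∫ u in b..w, δ * G u := by
    refine intervalIntegral.sub_le_integral_of_hasDeriv_right_of_le hbw
      (fun u hu => (hF' u (hb_pos.trans_le hu.1)).continuousAt.continuousWithinAt)
      (fun u hu => (hF' u (hb_pos.trans hu.1)).hasDerivWithinAt)
      ((hGm.mono fun u hu => hb_pos.le.trans hu.1).integrableOn_isCompact isCompact_Icc |>.const_mul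
        δ) fun u hu => ?_
    have F'_le := (le_abs_self _).trans (hb u hu.1.le)
    rwa [Real.norm_of_nonneg (nonneg_of_monotoneOn_Ici hGm hG (hb_pos.trans hu.1).le)] at F'_le
  rw [intervalIntegral.integral_const_mul, ← intervalIntegral.integral_interval_sub_left
    (integrable w hw) (integrable b hb_pos.le), mul_sub] at F_sub_le
  linarith [mul_nonneg hδ.le (integral_nonneg b hb_pos.le)]

theorem tendsto_atTop_of_not_bddAbove {h : ℝ → ℝ} (hm : MonotoneOn h (Ici 0))
    (h_unbdd : ¬ BddAbove (h '' Ici 0)) : Tendsto h atTop atTop := by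
  refine tendsto_atTop.2 fun b => ?_
  obtain ⟨_, ⟨u, hu, rfl⟩, hub⟩ := not_bddAbove_iff.1 h_unbdd b
  filter_upwards [eventually_ge_atTop u] with v hv
  exact hub.le.trans (hm hu (le_trans hu hv) hv)

theorem hasDerivAt_of_subexpCondition {h : ℝ → ℝ} (hs : SubexpCondition h) {u : ℝ} (hu : 0 < u) :
    HasDerivAt h (derivWithin h (Ici 0) u) u :=
  ((hs.1.differentiableOn one_ne_zero u hu.le).hasDerivWithinAt).hasDerivAt (Ici_mem_nhds hu)

theorem hasDerivAt_bigG (hs : ∀ i ∈ A, SubexpCondition (g i)) {u : ℝ} (hu : 0 < u) :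
    HasDerivAt (bigG g A)
      (∑ i ∈ A, bigG g (A.erase i) u * (2 * derivWithin (g i) (Ici 0) u)) u :=
  HasDerivAt.fun_finsetProd fun i hi =>
    ((hasDerivAt_of_subexpCondition (hs i hi) hu).const_mul 2).add_const 1

theorem continuousOn_bigG (hc : ∀ i ∈ A, ContinuousOn (g i) (Ici 0)) :
    ContinuousOn (bigG g A) (Ici 0) :=
  continuousOn_finsetProd A fun i hi => (continuousOn_const.mul (hc i hi)).add continuousOn_const

theorem hasDerivAt_hatG (hc : ∀ i ∈ A, ContinuousOn (g i) (Ici 0)) {u : ℝ} (hu : 0 < u) :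
    HasDerivAt (hatG g A) (faceG g A u) u := by
  have face_cont : ContinuousOn (faceG g A) (Ici 0) := continuousOn_finsetSum A fun i _ =>
    continuousOn_bigG fun l hl => hc l (Finset.mem_of_mem_erase hl)
  exact intervalIntegral.integral_hasDerivAt_right
    (face_cont.mono (by rw [uIcc_of_le hu.le]; exact Icc_subset_Ici_self)).intervalIntegrable
    ((face_cont.mono Ioi_subset_Ici_self).stronglyMeasurableAtFilter isOpen_Ioi u hu)
    (face_cont.continuousAt (Ici_mem_nhds hu))

theorem isLittleO_sum_bigG_erase_mul {f : Fin n → ℝ → ℝ}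
    (hf : ∀ i ∈ A, f i =o[atTop] fun u => 2 * g i u + 1) :
    (fun u => ∑ i ∈ A, bigG g (A.erase i) u * f i u) =o[atTop] bigG g A := by
  refine IsLittleO.fun_sum fun i hi => ?_
  have bigG_eq : bigG g A = fun u => bigG g (A.erase i) u * (2 * g i u + 1) := funext fun u =>
    (Finset.prod_erase_mul A _ hi).symm
  rw [bigG_eq]
  exact (isBigO_refl _ atTop).mul_isLittleO (hf i hi)

theorem isLittleO_faceG (hg : ∀ i ∈ A, Tendsto (g i) atTop atTop) :
    faceG g A =o[atTop] bigG g A := by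
  have one_isLittleO : ∀ i ∈ A, (fun _ => (1 : ℝ)) =o[atTop] fun u => 2 * g i u + 1 := fun i hi =>
    isLittleO_const_left.2 (Or.inr (tendsto_norm_atTop_atTop.comp
      (tendsto_atTop_add_const_right _ 1 ((hg i hi).const_mul_atTop two_pos))))
  have sum_isLittleO := isLittleO_sum_bigG_erase_mul one_isLittleO
  simp only [mul_one] at sum_isLittleO
  exact sum_isLittleO

theorem isLittleO_deriv_bigG (hg : ∀ i ∈ A, Tendsto (g i) atTop atTop)
    (hs : ∀ i ∈ A, SubexpCondition (g i)) :
    (fun u => ∑ i ∈ A, bigG g (A.erase i) u * (2 * derivWithin (g i) (Ici 0) u)) =o[atTop]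
      bigG g A := by
  refine isLittleO_sum_bigG_erase_mul fun i hi => IsLittleO.const_mul_left ?_ 2
  have g_pos := (hg i hi).eventually_gt_atTop 0
  have deriv_isLittleO : derivWithin (g i) (Ici 0) =o[atTop] g i :=
    (isLittleO_iff_tendsto' (g_pos.mono fun u hu h => absurd h hu.ne')).2 (hs i hi).2
  refine deriv_isLittleO.trans_isBigO (IsBigO.of_bound 1 (g_pos.mono fun u hu => ?_))
  rw [one_mul, Real.norm_of_nonneg hu.le, Real.norm_of_nonneg (by linarith)]
  linarith

end Growth

section LongRun

variable {ι : Type*} {l : Filter ι} {s : ι → ℝ≥0} {z : ι → ℝ} {G e : ℝ → ℝ}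

theorem tendsto_zero_of_forall_exists_le_add {f : ι → ℝ≥0∞}
    (h : ∀ ε ≠ 0, ∃ a : ι → ℝ≥0∞, Tendsto a l (𝓝 0) ∧ ∀ i, f i ≤ a i + ε) :
    Tendsto f l (𝓝 0) := by
  refine ENNReal.tendsto_nhds_zero.2 fun ε hε => ?_
  have half_pos := ENNReal.half_pos hε.ne'
  obtain ⟨a, ha, hfa⟩ := h (ε / 2) half_pos.ne'
  filter_upwards [ENNReal.tendsto_nhds_zero.1 ha _ half_pos] with i hi
  exact (hfa i).trans ((add_le_add_left hi _).trans_eq (ENNReal.add_halves ε))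

theorem le_integral_of_one_le (hGm : MonotoneOn G (Ici 0)) (hG : 1 ≤ G 0) {w : ℝ} (hw : 0 ≤ w) :
    w ≤ ∫ u in (0 : ℝ)..w, G u := by
  simpa using intervalIntegral.integral_mono_on (μ := volume) hw
    (intervalIntegrable_const (c := (1 : ℝ)))
    (intervalIntegrable_of_monotoneOn_Ici hGm le_rfl hw)
    fun u hu => hG.trans (hGm self_mem_Ici hu.1 hu.1)

/-- Either `ζ_s` is one of the `m` sites following `z`, or the primitive of `G` at `ζ_s - z` is at
least `m`, which Markov's inequality makes unlikely. -/
theorem srwLaw_beyond_le (hGm : MonotoneOn G (Ici 0)) (hG : 1 ≤ G 0) (s : ℝ≥0) (z : ℝ) {m : ℕ}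
    (hm : m ≠ 0) : srwLaw s {k : ℤ | z < (k : ℝ)} ≤
      m * (⨆ k : ℤ, srwLaw s {k}) + meanPrimitive G s z / m := by
  have beyond_subset : {k : ℤ | z < (k : ℝ)} ⊆ (Finset.Ioc ⌊z⌋ (⌊z⌋ + m) : Finset ℤ) ∪
      {k : ℤ | (m : ℝ≥0∞) ≤ ENNReal.ofReal (∫ u in (0 : ℝ)..(max ((k : ℝ) - z) 0), G u)} := by
    intro k hk
    rcases le_or_gt k (⌊z⌋ + m) with h_near | h_far
    · exact Or.inl (Finset.mem_coe.2 (Finset.mem_Ioc.2 ⟨Int.floor_lt.2 hk, h_near⟩))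
    · have far : (⌊z⌋ : ℝ) + m + 1 ≤ k := by exact_mod_cast h_far
      have hw : (m : ℝ) ≤ max ((k : ℝ) - z) 0 :=
        le_max_of_le_left (by linarith [Int.lt_floor_add_one z])
      refine Or.inr ?_
      rw [mem_ofPred_eq, ← ENNReal.ofReal_natCast]
      exact ENNReal.ofReal_le_ofReal
        (hw.trans (le_integral_of_one_le hGm hG (le_max_right _ _)))
  refine (measure_mono beyond_subset).trans ((measure_union_le _ _).trans (add_le_add ?_ ?_))
  · rw [← sum_measure_singleton]
    refine (Finset.sum_le_sum fun k _ => le_iSup (fun k => srwLaw s {k}) k).trans_eq ?_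
    rw [Finset.sum_const, Int.card_Ioc, add_sub_cancel_left, Int.toNat_natCast, nsmul_eq_mul]
  · exact meas_ge_le_lintegral_div (measurable_of_countable _).aemeasurable
      (Nat.cast_ne_zero.2 hm) (ENNReal.natCast_ne_top m)

theorem tendsto_srwLaw_beyond (hGm : MonotoneOn G (Ici 0)) (hG : 1 ≤ G 0)
    (hs : Tendsto s l atTop) (h_fin : ⨆ i, meanPrimitive G (s i) (z i) < ⊤) :
    Tendsto (fun i => srwLaw (s i) {k : ℤ | z i < (k : ℝ)}) l (𝓝 0) := by
  refine tendsto_zero_of_forall_exists_le_add fun ε hε => ?_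
  obtain ⟨m, hm⟩ := ENNReal.exists_nat_mul_gt hε h_fin.ne
  have m_ne_zero : m ≠ 0 := by
    rintro rfl
    simp at hm
  refine ⟨fun i => m * ⨆ k : ℤ, srwLaw (s i) {k}, ?_, fun i => ?_⟩
  · simpa using ENNReal.Tendsto.const_mul (tendsto_iSup_srwLaw_singleton.comp hs)
      (Or.inr (ENNReal.natCast_ne_top m))
  · refine (srwLaw_beyond_le hGm hG (s i) (z i) m_ne_zero).trans (add_le_add_right ?_ _)
    refine ENNReal.div_le_of_le_mul' ((le_iSup _ i).trans hm.le)

theorem meanBeyond_le {C δ : ℝ} (hδ : 0 ≤ δ)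
    (he : ∀ w, 0 ≤ w → e w ≤ C + δ * ∫ u in (0 : ℝ)..w, G u) (s : ℝ≥0) (z : ℝ) :
    meanBeyond e s z ≤ ENNReal.ofReal C * srwLaw s {k : ℤ | z < (k : ℝ)} +
      ENNReal.ofReal δ * meanPrimitive G s z := by
  rw [ofReal_mul_meanPrimitive hδ, meanBeyond, ← setLIntegral_const]
  refine le_trans ?_ (add_le_add_right (setLIntegral_le_lintegral {k : ℤ | z < (k : ℝ)} _) _)
  rw [← lintegral_add_left measurable_const]
  refine setLIntegral_mono' MeasurableSet.of_discrete fun k hk => ?_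
  have hw : 0 ≤ (k : ℝ) - z := sub_nonneg.2 (le_of_lt hk)
  rw [max_eq_left hw]
  exact (ENNReal.ofReal_le_ofReal (he _ hw)).trans ENNReal.ofReal_add_le

theorem tendsto_meanBeyond (hGm : MonotoneOn G (Ici 0)) (hG : 1 ≤ G 0)
    (he : ∀ δ, 0 < δ → ∃ C, ∀ w, 0 ≤ w → e w ≤ C + δ * ∫ u in (0 : ℝ)..w, G u)
    (hs : Tendsto s l atTop) (h_fin : ⨆ i, meanPrimitive G (s i) (z i) < ⊤) :
    Tendsto (fun i => meanBeyond e (s i) (z i)) l (𝓝 0) := by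
  refine tendsto_zero_of_forall_exists_le_add fun ε hε => ?_
  obtain ⟨δ, δ_pos, hδ⟩ := ENNReal.exists_nnreal_pos_mul_lt h_fin.ne hε
  obtain ⟨C, hC⟩ := he δ δ_pos
  refine ⟨fun i => ENNReal.ofReal C * srwLaw (s i) {k : ℤ | z i < (k : ℝ)}, ?_, fun i => ?_⟩
  · simpa using ENNReal.Tendsto.const_mul (tendsto_srwLaw_beyond hGm hG hs h_fin)
      (Or.inr ENNReal.ofReal_ne_top)
  · refine (meanBeyond_le δ.coe_nonneg hC (s i) (z i)).trans (add_le_add_right ?_ _)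
    rw [ENNReal.ofReal_coe_nnreal]
    exact (mul_le_mul_right (le_iSup _ i) _).trans hδ.le

theorem tendsto_meanError {n : ℕ} {g : Fin n → ℝ → ℝ} {A : Finset (Fin n)}
    (hg : ∀ i, ∀ u, 0 ≤ u → 0 ≤ g i u) (hm : ∀ i, MonotoneOn (g i) (Ici 0))
    (h_unbdd : ∀ i ∈ A, ¬ BddAbove (g i '' Ici 0)) (h_sub : ∀ i ∈ A, SubexpCondition (g i))
    (hs : Tendsto s l atTop) (h_fin : ⨆ i, meanIntG g A (s i) (z i) < ⊤) :
    Tendsto (fun i => meanError g A (s i) (z i)) l (𝓝 0) := by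
  have hG_mono : MonotoneOn (bigG g A) (Ici 0) := monotoneOn_bigG hg hm
  have hG_one : 1 ≤ bigG g A 0 := one_le_bigG fun i => hg i 0 le_rfl
  have hg_atTop : ∀ i ∈ A, Tendsto (g i) atTop atTop := fun i hi =>
    tendsto_atTop_of_not_bddAbove (hm i) (h_unbdd i hi)
  have hatG_mono : MonotoneOn (hatG g A) (Ici 0) := fun a ha b _ hab =>
    integral_mono_right (monotoneOn_faceG hg hm) (faceG_nonneg fun i => hg i 0 le_rfl) ha hab
  have bigG_tendsto := tendsto_meanBeyond hG_mono hG_one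
    (fun δ => exists_le_add_mul_integral hG_mono (fun u => hasDerivAt_bigG h_sub) hG_mono
      (zero_le_one.trans hG_one) (isLittleO_deriv_bigG hg_atTop h_sub)) hs h_fin
  have hatG_tendsto := tendsto_meanBeyond hG_mono hG_one
    (fun δ => exists_le_add_mul_integral hatG_mono
      (fun u => hasDerivAt_hatG fun i hi => (h_sub i hi).1.continuousOn) hG_mono
      (zero_le_one.trans hG_one) (isLittleO_faceG hg_atTop)) hs h_fin
  rw [← add_zero 0]
  exact bigG_tendsto.add hatG_tendsto

end LongRun

section Estimate

variable {n : ℕ} {g : Fin n → ℝ → ℝ} {A : Finset (Fin n)}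

theorem mem_unboundedIdx {i : Fin n} : i ∈ unboundedIdx g ↔ ¬ BddAbove (g i '' Ici 0) := by
  simp [unboundedIdx]

theorem layerSum_of_nonpos {w : ℝ} (hw : w ≤ 0) : layerSum g w = 0 := by
  rw [layerSum, Nat.ceil_eq_zero.2 hw, Finset.sum_range_zero]

theorem lintegral_layerSum_estimate {Λ C : ℝ} (hΛ : 0 ≤ Λ) (hC : 0 ≤ C)
    (h_abs : ∀ w, 0 < w → |layerSum g w - Λ * ∫ u in (0 : ℝ)..w, bigG g A u| ≤
      C * (bigG g A w + hatG g A w)) (s : ℝ≥0) (z : ℝ) :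
    ∫⁻ k : ℤ, ENNReal.ofReal (layerSum g (k - z)) ∂(srwLaw s) ≤
        ENNReal.ofReal Λ * meanIntG g A s z + ENNReal.ofReal C * meanError g A s z ∧
      ENNReal.ofReal Λ * meanIntG g A s z ≤
        ∫⁻ k : ℤ, ENNReal.ofReal (layerSum g (k - z)) ∂(srwLaw s) +
          ENNReal.ofReal C * meanError g A s z := by
  set q : ℝ → ℝ := fun w => Λ * ∫ u in (0 : ℝ)..max w 0, bigG g A u
  have eq_of_nonpos : ∀ w ≤ 0, layerSum g w = q w := fun w hw => by
    simp only [q]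
    rw [layerSum_of_nonpos hw, max_eq_right hw, intervalIntegral.integral_same, mul_zero]
  have abs_le : ∀ w, 0 < w → |layerSum g w - q w| ≤ C * (bigG g A w + hatG g A w) :=
    fun w hw => by
      simp only [q]
      rw [max_eq_left hw.le]
      exact h_abs w hw
  have error_le : ENNReal.ofReal C * meanBeyond (fun w => bigG g A w + hatG g A w) s z ≤
      ENNReal.ofReal C * meanError g A s z := mul_le_mul_right (meanBeyond_add_le _ _ s z) _
  rw [meanIntG_eq_meanPrimitive, ofReal_mul_meanPrimitive hΛ]
  exact ⟨(lintegral_ofReal_le_add_meanBeyond hC eq_of_nonpos abs_le s z).trans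
      (add_le_add_right error_le _),
    (lintegral_ofReal_le_add_meanBeyond hC (fun w hw => (eq_of_nonpos w hw).symm)
      (fun w hw => (abs_sub_comm _ _).trans_le (abs_le w hw)) s z).trans
      (add_le_add_right error_le _)⟩

theorem meanIntG_lt_top (hg : ∀ i, ∀ u, 0 ≤ u → 0 ≤ g i u) (hm : ∀ i, MonotoneOn (g i) (Ici 0))
    {s : ℝ≥0} {z : ℝ} (h_fin : meanBeyond (bigG g A) s z < ⊤) : meanIntG g A s z < ⊤ :=
  meanPrimitive_lt_top (monotoneOn_bigG hg hm) h_fin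

end Estimate

theorem lemma3p2_general (n : ℕ) (g : Fin n → ℝ → ℝ)
    (hg_nonneg : ∀ i, ∀ u, 0 ≤ u → 0 ≤ g i u)
    (hg_mono : ∀ i, MonotoneOn (g i) (Ici 0)) :
    (∃ L : Fin n → ℝ,
      (∀ i ∈ (unboundedIdx g)ᶜ,
        Tendsto (fun u : ℝ => 2 * (⌊g i u⌋ : ℝ) + 1) atTop (𝓝 (L i))) ∧
      ∃ C : ℝ, 0 < C ∧
        ∀ (Ω : Type*) [MeasurableSpace Ω] (P : Measure Ω) [IsProbabilityMeasure P]
          (η : ℝ≥0 → Ω → Config (n + 1)), IsExclusionProcess (n + 1) P η (shapeProfile g) →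
        ∀ (z : ℝ≥0 → ℝ) (t : ℝ≥0),
          ((∫⁻ ω, numBeyond (η t ω) (z t) ∂P) ≤
            ENNReal.ofReal (∏ i ∈ (unboundedIdx g)ᶜ, L i) *
                meanIntG g (unboundedIdx g) (t / ((n + 1 : ℕ) : ℝ≥0)) (z t) +
              ENNReal.ofReal C *
                meanError g (unboundedIdx g) (t / ((n + 1 : ℕ) : ℝ≥0)) (z t)) ∧
          (ENNReal.ofReal (∏ i ∈ (unboundedIdx g)ᶜ, L i) *
                meanIntG g (unboundedIdx g) (t / ((n + 1 : ℕ) : ℝ≥0)) (z t) ≤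
            (∫⁻ ω, numBeyond (η t ω) (z t) ∂P) +
              ENNReal.ofReal C *
                meanError g (unboundedIdx g) (t / ((n + 1 : ℕ) : ℝ≥0)) (z t)) ∧
          (meanError g (unboundedIdx g) (t / ((n + 1 : ℕ) : ℝ≥0)) (z t) < ⊤ →
            (∫⁻ ω, numBeyond (η t ω) (z t) ∂P) < ⊤ ∧
            meanIntG g (unboundedIdx g) (t / ((n + 1 : ℕ) : ℝ≥0)) (z t) < ⊤)) ∧
    (∀ z : ℝ≥0 → ℝ,
      (∀ i ∈ unboundedIdx g, SubexpCondition (g i)) →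
      (⨆ t : ℝ≥0, meanIntG g (unboundedIdx g) (t / ((n + 1 : ℕ) : ℝ≥0)) (z t)) < ⊤ →
      Tendsto (fun t : ℝ≥0 => meanError g (unboundedIdx g) (t / ((n + 1 : ℕ) : ℝ≥0)) (z t))
        atTop (𝓝 0)) := by
  obtain ⟨L, L_tendsto, prod_nonneg, C, C_pos, abs_le⟩ :=
    exists_abs_layerSum_sub_le (A := unboundedIdx g) hg_nonneg hg_mono fun i hi =>
      not_not.1 (mt mem_unboundedIdx.2 (Finset.mem_compl.1 hi))
  refine ⟨⟨L, L_tendsto, C, C_pos, fun Ω _ P _ η hη z t => ?_⟩, fun z h_sub h_fin =>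
    tendsto_meanError hg_nonneg hg_mono (fun i => mem_unboundedIdx.1) h_sub
      (tendsto_id.atTop_div_const (by positivity)) h_fin⟩
  rw [lintegral_numBeyond hg_nonneg hη]
  obtain ⟨upper, lower⟩ := lintegral_layerSum_estimate prod_nonneg C_pos.le abs_le
    (t / ((n + 1 : ℕ) : ℝ≥0)) (z t)
  refine ⟨upper, lower, fun error_lt_top => ?_⟩
  have main_lt_top :=
    meanIntG_lt_top hg_nonneg hg_mono (ENNReal.add_lt_top.1 error_lt_top).1
  exact ⟨upper.trans_lt (ENNReal.add_lt_top.2 ⟨ENNReal.mul_lt_top ENNReal.ofReal_lt_top main_lt_top,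
    ENNReal.mul_lt_top ENNReal.ofReal_lt_top error_lt_top⟩), main_lt_top⟩

theorem lemma3p2 (n : ℕ) (hn : 1 ≤ n) (g : Fin n → ℝ → ℝ)
    (hg_nonneg : ∀ i, ∀ u, 0 ≤ u → 0 ≤ g i u)
    (hg_cont : ∀ i, ContinuousOn (g i) (Ici 0))
    (hg_mono : ∀ i, MonotoneOn (g i) (Ici 0)) :
    (∃ L : Fin n → ℝ,
      (∀ i ∈ (unboundedIdx g)ᶜ,
        Tendsto (fun u : ℝ => 2 * (⌊g i u⌋ : ℝ) + 1) atTop (𝓝 (L i))) ∧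
      ∃ C : ℝ, 0 < C ∧
        ∀ (Ω : Type*) [MeasurableSpace Ω] (P : Measure Ω) [IsProbabilityMeasure P]
          (η : ℝ≥0 → Ω → Config (n + 1)), IsExclusionProcess (n + 1) P η (shapeProfile g) →
        ∀ (z : ℝ≥0 → ℝ) (t : ℝ≥0),
          ((∫⁻ ω, numBeyond (η t ω) (z t) ∂P) ≤
            ENNReal.ofReal (∏ i ∈ (unboundedIdx g)ᶜ, L i) *
                meanIntG g (unboundedIdx g) (t / ((n + 1 : ℕ) : ℝ≥0)) (z t) +
              ENNReal.ofReal C *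
                meanError g (unboundedIdx g) (t / ((n + 1 : ℕ) : ℝ≥0)) (z t)) ∧
          (ENNReal.ofReal (∏ i ∈ (unboundedIdx g)ᶜ, L i) *
                meanIntG g (unboundedIdx g) (t / ((n + 1 : ℕ) : ℝ≥0)) (z t) ≤
            (∫⁻ ω, numBeyond (η t ω) (z t) ∂P) +
              ENNReal.ofReal C *
                meanError g (unboundedIdx g) (t / ((n + 1 : ℕ) : ℝ≥0)) (z t)) ∧
          (meanError g (unboundedIdx g) (t / ((n + 1 : ℕ) : ℝ≥0)) (z t) < ⊤ →
            (∫⁻ ω, numBeyond (η t ω) (z t) ∂P) < ⊤ ∧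
            meanIntG g (unboundedIdx g) (t / ((n + 1 : ℕ) : ℝ≥0)) (z t) < ⊤)) ∧
    (∀ z : ℝ≥0 → ℝ,
      (∀ i ∈ unboundedIdx g, SubexpCondition (g i)) →
      (⨆ t : ℝ≥0, meanIntG g (unboundedIdx g) (t / ((n + 1 : ℕ) : ℝ≥0)) (z t)) < ⊤ →
      Tendsto (fun t : ℝ≥0 => meanError g (unboundedIdx g) (t / ((n + 1 : ℕ) : ℝ≥0)) (z t))
        atTop (𝓝 0)) := by
  exact lemma3p2_general n g hg_nonneg hg_mono
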